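/- For $N,L\in\mathbb N$ let $\Lambda_N=\{1,\dots,N\}$ and, for a finite set $A$ and $m\in\mathbb Z_+$, let $\Omega(A,m)=\{\eta\in\mathbb Z_+^A:\sum_{x\in A}\eta(x)=m\}$; write $\Omega_N(L)=\Omega(\Lambda_N,L)$. Let $g:\mathbb Z_+\to[0,\infty)$ with $g(0)>0$, put $G(k)=\sum_{j=0}^k g(j)$, and let $\rho_N$ be a probability distribution on $\mathcal D_N=\{A\subset\Lambda_N:|A|\ge 2\}$ (so $N\ge2$). Consider the following time-homogeneous Markov chains on $\Omega_N(L)$. In each, one step from $\xi$ begins by choosing $A\in\mathcal D_N$ with law $\rho_N$ and leaves the coordinates outside $A$ unchanged. - *Immediate exchange model* $X_n^{(N)}$: given $A$, choose independent $c(x)$, $x\in A$, with $P(c(x)=k)=g(k)/G(\xi(x))$ for $0\le k\le\xi(x)$, and, independently, a uniformly random permutation $\sigma$ of $A$; the new value at $z\in A$ is $\xi(z)-c(z)+c(\sigma^{-1}(z))$. - *Random saving model* $Y_n^{(N)}$: given $A$, choose $c(x)$, $x\in A$, as above, then $d$ uniformly in $\Omega\bigl(A,\sum_{x\in A}\xi(x)-\sum_{x\in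 A}c(x)\bigr)$; the new value at $z\in A$ is $c(z)+d(z)$. - *Uniform reshuffling model* $Z_n^{(N)}$: the random saving model with $g=\delta_0$, that is, $g(0)=1$ and $g(k)=0$ for $k\ge1$. Let $(L_N)_{N\ge1}$ be positive integers and $(a_N)_{N\ge1}$ real numbers with $a_N\to\infty$ and $\frac{L_N}{Na_N}\to T$ for some $T\in(0,\infty)$. Assume that, for every $N\ge2$, the hypergraph on $\Lambda_N$ with hyperedge set $\{A\in\mathcal D_N:\rho_N(A)>0\}$ is connected. Take $L=L_N$ in the chains above. Let $\pi_T(dr)=\frac1T e^{-r/T}dr$ on $[0,\infty)$. For $\alpha\in\mathbb R$ let $\mu_{\alpha,T}(dr)=\frac1{\Gamma(\alpha+2)}\bigl(\frac{\alpha+2}{T}\bigr)^{\alpha+2}r^{\alpha+1}e^{-\frac{\alpha+2}{T}r}dr$ on $[0,\infty)$ if $\alpha>-1$, and $\mu_{\alpha,T}=\pi_T$ if $\alpha\le-1$. Let $0\le b<c\le\infty$, and let $E_\eta$ be the expectation for the chain started at $\eta$. Each of the following iterated limits exists and has the stated value. For each $N\ge2$ the inner limit exists for every $\eta\in\Omega_N(L_N)$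 and does not depend on $\eta$. 1. Suppose that $g(k)/k^\alpha\to c_\alpha$ as $k\to\infty$ for some $\alpha\in\mathbb R$ and $c_\alpha\in(0,\infty)$. If also $g(1)>0$, then $$\lim_{N\to\infty}\lim_{n\to\infty}E_\eta\Bigl[\tfrac1N\bigl|\{x\in\Lambda_N:\tfrac1{a_N}X^{(N)}_n(x)\in(b,c)\}\bigr|\Bigr]=\mu_{\alpha,T}((b,c)).$$ Without assuming $g(1)>0$, $$\lim_{N\to\infty}\lim_{n\to\infty}E_\eta\Bigl[\tfrac1N\bigl|\{x\in\Lambda_N:\tfrac1{a_N}Y^{(N)}_n(x)\in(b,c)\}\bigr|\Bigr]=\mu_{\alpha,T}((b,c)).$$ 2. If instead $\sum_{j\ge0}g(j)<\infty$, then the same two statements hold with $\pi_T((b,c))$ in place of $\mu_{\alpha,T}((b,c))$ (again assuming $g(1)>0$ for $X^{(N)}$ only). 3. With no further assumption, $$\lim_{N\to\infty}\lim_{n\to\infty}E_\eta\Bigl[\tfrac1N\bigl|\{x\in\Lambda_N:\tfrac1{a_N}Z^{(N)}_n(x)\in(b,c)\}\bigr|\Bigr]=\pi_T((b,c)).$$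 -/

import Mathlib

open Filter Topology MeasureTheory ProbabilityTheory
open scoped NNReal ENNReal

namespace MoneyExchange

/-- The configuration space `Ω(A, L)`: distributions of `L` coins among the agents in `A`. -/
def Config (A : Type) [Fintype A] (L : ℕ) : Type :=
  {η : A → ℕ // ∑ x, η x = L}

namespace Config

variable {A : Type} [Fintype A] {L : ℕ}

instance : CoeFun (Config A L) (fun _ => A → ℕ) := ⟨Subtype.val⟩

instance : Finite (Config A L) := by
  have hle : ∀ (η : Config A L) (x : A), η x < L + 1 := fun η x =>
    Nat.lt_succ_of_le ((Finset.single_le_sum (f := η.1) (fun _ _ => Nat.zero_le _)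
      (Finset.mem_univ x)).trans_eq η.2)
  refine Finite.of_injective (fun η : Config A L => fun x : A => (⟨η x, hle η x⟩ : Fin (L + 1))) ?_
  intro η ζ h
  apply Subtype.ext
  funext x
  simpa using congrFun h x

noncomputable instance : Fintype (Config A L) := Fintype.ofFinite _

instance [Nonempty A] : Nonempty (Config A L) := by
  classical
  obtain ⟨x⟩ := ‹Nonempty A›
  exact ⟨⟨Pi.single x L, by simp⟩⟩

/-- Every subset of the finite space `Ω(A, L)` is measurable. -/
instance : MeasurableSpace (Config A L) := ⊤

instance : DiscreteMeasurableSpace (Config A L) := ⟨fun _ => trivial⟩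

/-- Replace the holdings of the agents in `B` by `v`, which has the same total, and leave the
holdings of all other agents unchanged. -/
def updateOn [DecidableEq A] (ξ : Config A L) (B : Finset A) (v : B → ℕ)
    (hv : ∑ x, v x = ∑ x : B, ξ x) : Config A L :=
  ⟨fun z => if h : z ∈ B then v ⟨z, h⟩ else ξ z, by
    have h1 : ∑ z ∈ B, (if h : z ∈ B then v ⟨z, h⟩ else ξ z) = ∑ z ∈ B, ξ z := by
      rw [← Finset.sum_coe_sort B, ← Finset.sum_coe_sort B, ← hv]
      exact Finset.sum_congr rfl fun x _ => by simp
    have h2 : ∑ z ∈ Bᶜ, (if h : z ∈ B then v ⟨z, h⟩ else ξ z) = ∑ z ∈ Bᶜ, ξ z :=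
      Finset.sum_congr rfl fun z hz => by simp [Finset.mem_compl.1 hz]
    rw [← Finset.sum_add_sum_compl B, h1, h2, Finset.sum_add_sum_compl, ξ.2]⟩

end Config

/-- The family `𝒟_N` of sets of at least two of the `N` agents. -/
abbrev ExchangeSet (N : ℕ) : Type := {A : Finset (Fin N) // 2 ≤ A.card}

instance {N : ℕ} (A : ExchangeSet N) : Nonempty A.1 :=
  (Finset.card_pos.1 (lt_of_lt_of_le Nat.zero_lt_two A.2)).to_subtype

/-- Connectedness of the hypergraph on the `N` agents whose hyperedges are the sets that `ρ`
charges: any two agents are joined by a chain of successively intersecting hyperedges. -/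
def HypergraphConnected {N : ℕ} (ρ : PMF (ExchangeSet N)) : Prop :=
  ∀ x y : Fin N,
    Relation.ReflTransGen (fun u v => ∃ A : ExchangeSet N, 0 < ρ A ∧ u ∈ A.1 ∧ v ∈ A.1) x y

/-- `G(k) = g(0) + ⋯ + g(k)`. -/
def G (g : ℕ → ℝ≥0) (k : ℕ) : ℝ≥0 := ∑ j ∈ Finset.range (k + 1), g j

lemma G_pos {g : ℕ → ℝ≥0} (hg : 0 < g 0) (k : ℕ) : 0 < G g k :=
  lt_of_lt_of_le hg (Finset.single_le_sum (f := g) (fun _ _ => zero_le)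
    (Finset.mem_range.2 k.succ_pos))

/-- The law on `{0, …, k}` that gives `j` the probability `g(j) / G(k)`. -/
noncomputable def coinLaw (g : ℕ → ℝ≥0) (hg : 0 < g 0) (k : ℕ) : PMF (Fin (k + 1)) :=
  PMF.ofFintype (fun j => ((g j / G g k : ℝ≥0) : ℝ≥0∞)) (by
    rw [← ENNReal.ofNNReal_finsetSum, ← Finset.sum_div, Fin.sum_univ_eq_sum_range g (k + 1)]
    exact_mod_cast div_self (G_pos hg k).ne')

/-- The joint law of finitely many independent random variables with laws `p i`. -/
noncomputable def indepLaw {ι : Type} [Fintype ι] [DecidableEq ι] {β : ι → Type}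
    [∀ i, Fintype (β i)] (p : ∀ i, PMF (β i)) : PMF (∀ i, β i) :=
  PMF.ofFintype (fun c => ∏ i, p i (c i)) (by
    rw [← Fintype.prod_sum]
    exact Finset.prod_eq_one fun i _ => (tsum_fintype (p i)).symm.trans (p i).tsum_coe)

variable {N L : ℕ}

/-- One step of the immediate exchange model from `ξ`: choose `A` with law `ρ`, independent
`c(x)`, `x ∈ A`, with laws `coinLaw g hg (ξ x)`, and a uniform permutation `σ` of `A`; each agent
`x ∈ A` passes `c(x)` coins to `σ(x)`. -/
noncomputable def immediateExchange (g : ℕ → ℝ≥0) (hg : 0 < g 0) (ρ : PMF (ExchangeSet N))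
    (ξ : Config (Fin N) L) : PMF (Config (Fin N) L) :=
  ρ.bind fun A =>
    (indepLaw fun x : A.1 => coinLaw g hg (ξ x)).bind fun c =>
      (PMF.uniformOfFintype (Equiv.Perm A.1)).map fun σ =>
        ξ.updateOn A.1 (fun z => ξ z - (c z : ℕ) + (c (σ⁻¹ z) : ℕ)) (by
          have h1 : ∑ z : A.1, (c (σ⁻¹ z) : ℕ) = ∑ z : A.1, (c z : ℕ) :=
            Equiv.sum_comp σ⁻¹ fun z : A.1 => (c z : ℕ)
          rw [Finset.sum_add_distrib, h1, ← Finset.sum_add_distrib]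
          exact Finset.sum_congr rfl fun z _ => Nat.sub_add_cancel (Nat.le_of_lt_succ (c z).2))

/-- One step of the random saving model from `ξ`: choose `A` with law `ρ` and independent `c(x)`,
`x ∈ A`, with laws `coinLaw g hg (ξ x)`; each agent `x ∈ A` saves `c(x)` coins, and the other
coins of the agents in `A` are pooled and redistributed among them by a uniform `d`. -/
noncomputable def randomSaving (g : ℕ → ℝ≥0) (hg : 0 < g 0) (ρ : PMF (ExchangeSet N))
    (ξ : Config (Fin N) L) : PMF (Config (Fin N) L) :=
  ρ.bind fun A =>
    (indepLaw fun x : A.1 => coinLaw g hg (ξ x)).bind fun c =>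
      (PMF.uniformOfFintype
          (Config A.1 (∑ x : A.1, ξ x - ∑ x : A.1, (c x : ℕ)))).map fun d =>
        ξ.updateOn A.1 (fun z => (c z : ℕ) + d z) (by
          rw [Finset.sum_add_distrib, d.2]
          exact Nat.add_sub_cancel'
            (Finset.sum_le_sum fun z _ => Nat.le_of_lt_succ (c z).2))

/-- One step of the uniform reshuffling model: random saving with `g = δ₀`, so nothing is
saved. -/
noncomputable def uniformReshuffling (ρ : PMF (ExchangeSet N)) (ξ : Config (Fin N) L) :
    PMF (Config (Fin N) L) :=
  randomSaving (Pi.single 0 1) (by simp) ρ ξ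

/-- The transition kernel with one-step laws `step`. -/
noncomputable def stepKernel {S : Type} [MeasurableSpace S] [DiscreteMeasurableSpace S]
    (step : S → PMF S) : Kernel S S :=
  ⟨fun s => (step s).toMeasure, .of_discrete⟩

instance {S : Type} [MeasurableSpace S] [DiscreteMeasurableSpace S]
    (step : S → PMF S) : IsMarkovKernel (stepKernel step) :=
  ⟨fun s => inferInstanceAs (IsProbabilityMeasure (step s).toMeasure)⟩

/-- The law `P_η` on the path space of the time-homogeneous Markov chain with one-step laws `step`
and initial state `η` (by the Ionescu-Tulcea theorem). -/
noncomputable def chainLaw {S : Type} [MeasurableSpace S] [DiscreteMeasurableSpace S]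
    (step : S → PMF S) (η : S) : Measure (ℕ → S) :=
  Kernel.traj (X := fun _ : ℕ => S)
    (fun n => (stepKernel step).comap
      (fun past : (∀ _ : Finset.Iic n, S) => past ⟨n, Finset.mem_Iic.2 le_rfl⟩)
      (measurable_pi_apply _)) 0 (fun _ => η)

/-- `E_η[N⁻¹ |{x : X_n(x) / a ∈ I}|]` for the chain with one-step laws `step` started at `η`. -/
noncomputable def expectedFraction (step : Config (Fin N) L → PMF (Config (Fin N) L))
    (η : Config (Fin N) L) (a : ℝ) (I : Set ℝ) (n : ℕ) : ℝ :=
  ∫ X, (1 / (N : ℝ)) * ({x : Fin N | 1 / a * (X n x : ℝ) ∈ I}.ncard : ℝ) ∂(chainLaw step η)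

/-- The iterated limit, first as `n → ∞` and then as `N → ∞`, of the expected fraction of agents
whose scaled wealth lies in `I` exists and equals `p`, from any initial configurations. -/
def IteratedLimit {L : ℕ → ℕ}
    (step : ∀ N, 2 ≤ N → Config (Fin N) (L N) → PMF (Config (Fin N) (L N)))
    (a : ℕ → ℝ) (I : Set ℝ) (p : ℝ) : Prop :=
  ∃ l : ℕ → ℝ,
    (∀ (N : ℕ) (hN : 2 ≤ N) (η : Config (Fin N) (L N)),
      Tendsto (fun n => expectedFraction (step N hN) η (a N) I n) atTop (𝓝 (l N))) ∧
    Tendsto l atTop (𝓝 p)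

/-- The exponential law `π_T` with mean `T`. -/
noncomputable def expLaw (T : ℝ) : Measure ℝ := expMeasure (1 / T)

/-- The law `μ_{α,T}`: the Gamma law with shape `α + 2` and mean `T` if `α > -1`, and the
exponential law with mean `T` if `α ≤ -1`. -/
noncomputable def limitLaw (α T : ℝ) : Measure ℝ :=
  open Classical in if -1 < α then gammaMeasure (α + 2) ((α + 2) / T) else expLaw T

/-- The open interval `(b, c)` of real numbers, where `c = ∞` is allowed. -/
def openInterval (b : ℝ) (c : EReal) : Set ℝ := {r | b < r ∧ (r : EReal) < c}

end MoneyExchange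

/-! For fixed `N`, both dynamics leave the weight `∏ x, G(ξ(x))` invariant. The law of `c(x)` has
denominator `G(ξ(x))`, so multiplying it by the weight leaves a joint weight to which an agent of
`A` contributes only `g(c(x))`. Permuting the picked coins, or swapping the unsaved coins with the
redistributed ones, is then a weight-preserving bijection. Single coins can be carried along
hyperedges and every configuration can stay put, so the chain is irreducible and aperiodic. By
`tendsto_pow_mulVec` the inner limit is `equilibriumFraction`: the expected fraction for iid wealths
with weights `G(k)`, conditioned on total `L`.

In every case `G` varies regularly (`RegularGrowth`), with index `β = α + 1` if `α > -1` and `β = 0`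
otherwise or if `g` is summable. Since the total is fixed, an exponential tilt `e^{-sk}` does not
change the conditioned law. With `s = θ/a` and `θ = (β+1)/T`, the tilted law of one agent, scaled by
`a`, converges to the Gamma law with shape `β + 1` and mean `T` (`tendsto_tiltedMass`). It remains
to show that conditioning on the total does not change the expected fraction in the limit.

This needs only crude large-deviation bounds. By `eventually_convPow_ge`, the tilted product law
gives the total `L` probability at least `e^{-εN}/(L+1)`; monotonicity of `G` is what allows smaller
totals to be compared with `L`. By Jensen and a Chernoff estimate (`exp_mean_mul_convPow_le`), a
shift of order `N` in the conditioned mean of a count would contradict this bound. The factor `L+1`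
need not be subexponential in `N`, but the Chernoff bound carries the largest tilted weight of a
single agent, which is `O(1/a)` relative to the partition function, and `(L+1)/a` is `O(N)`
(`eventually_prefactor_le`). -/

namespace MoneyExchange

/-! ### Convergence to equilibrium of finite Markov chains -/

section FiniteChain

variable {S : Type} [Fintype S]

/-- The matrix of one-step transition probabilities. -/
noncomputable def transitionMatrix (step : S → PMF S) : Matrix S S ℝ :=
  fun s t => (step s t).toReal

omit [Fintype S] in
lemma transitionMatrix_nonneg (step : S → PMF S) (s t : S) : 0 ≤ transitionMatrix step s t :=
  ENNReal.toReal_nonneg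

omit [Fintype S] in
lemma transitionMatrix_pos {step : S → PMF S} {s t : S} (h : 0 < step s t) :
    0 < transitionMatrix step s t :=
  ENNReal.toReal_pos h.ne' ((step s).apply_ne_top t)

lemma sum_transitionMatrix (step : S → PMF S) (s : S) : ∑ t, transitionMatrix step s t = 1 := by
  unfold transitionMatrix
  rw [← ENNReal.toReal_sum fun t _ => (step s).apply_ne_top t, ← tsum_fintype (L := .unconditional S),
    (step s).tsum_coe, ENNReal.toReal_one]

variable [DecidableEq S]

lemma pow_nonneg_entries {P : Matrix S S ℝ} (hP : ∀ s t, 0 ≤ P s t) (n : ℕ) (s t : S) :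
    0 ≤ (P ^ n) s t := by
  induction n generalizing t with
  | zero => rw [pow_zero, Matrix.one_apply]; split_ifs <;> norm_num
  | succ n ih =>
    rw [pow_succ, Matrix.mul_apply]
    exact Finset.sum_nonneg fun u _ => mul_nonneg (ih u) (hP u t)

lemma pow_row_sum {P : Matrix S S ℝ} (hP : ∀ s, ∑ t, P s t = 1) (n : ℕ) (s : S) :
    ∑ t, (P ^ n) s t = 1 := by
  induction n with
  | zero => simp [Matrix.one_apply]
  | succ n ih =>
    simp_rw [pow_succ, Matrix.mul_apply]
    rw [Finset.sum_comm]
    simp_rw [← Finset.mul_sum, hP, mul_one, ih]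

lemma pow_succ_entry_pos {P : Matrix S S ℝ} (hP : ∀ s t, 0 ≤ P s t) {n : ℕ} {s t u : S}
    (h1 : 0 < (P ^ n) s t) (h2 : 0 < P t u) : 0 < (P ^ (n + 1)) s u := by
  rw [pow_succ, Matrix.mul_apply]
  exact (mul_pos h1 h2).trans_le (Finset.single_le_sum (f := fun j => (P ^ n) s j * P j u)
    (fun j _ => mul_nonneg (pow_nonneg_entries hP n s j) (hP j u)) (Finset.mem_univ t))

/-- An irreducible nonnegative matrix with positive diagonal has a strictly positive power. -/
lemma exists_pow_pos {P : Matrix S S ℝ} (hP : ∀ s t, 0 ≤ P s t) (hd : ∀ s, 0 < P s s)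
    (hc : ∀ s t, Relation.ReflTransGen (fun s t => 0 < P s t) s t) :
    ∃ n, 0 < n ∧ ∀ s t, 0 < (P ^ n) s t := by
  have hmono : ∀ {m n : ℕ}, m ≤ n → ∀ s t, 0 < (P ^ m) s t → 0 < (P ^ n) s t := by
    intro m n hmn s t h
    induction n, hmn using Nat.le_induction with
    | base => exact h
    | succ n _ ih => exact pow_succ_entry_pos hP ih (hd t)
  have hex : ∀ s t, ∃ n, 0 < (P ^ n) s t := by
    intro s t
    induction hc s t with
    | refl => exact ⟨0, by simp⟩
    | tail _ h ih =>
      obtain ⟨n, hn⟩ := ih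
      exact ⟨n + 1, pow_succ_entry_pos hP hn h⟩
  choose n hn using hex
  refine ⟨(∑ s, ∑ t, n s t) + 1, Nat.succ_pos _, fun s t => hmono ?_ s t (hn s t)⟩
  have h1 : n s t ≤ ∑ t, n s t :=
    Finset.single_le_sum (f := fun t => n s t) (fun _ _ => Nat.zero_le _) (Finset.mem_univ t)
  have h2 : ∑ t, n s t ≤ ∑ s, ∑ t, n s t :=
    Finset.single_le_sum (f := fun s => ∑ t, n s t) (fun _ _ => Nat.zero_le _) (Finset.mem_univ s)
  omega

omit [DecidableEq S] in
/-- Doeblin's contraction of the oscillation by a stochastic matrix with entries at least `ε`. -/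
lemma oscillation_contract {Q : Matrix S S ℝ} {ε D : ℝ} (hQ : ∀ s t, ε ≤ Q s t)
    (hs : ∀ s, ∑ t, Q s t = 1) {f : S → ℝ} (hf : ∀ s t, f s - f t ≤ D) (s t : S) :
    (Q.mulVec f) s - (Q.mulVec f) t ≤ (1 - Fintype.card S * ε) * D := by
  have : Nonempty S := ⟨s⟩
  obtain ⟨u, hu⟩ := Finite.exists_max f
  obtain ⟨v, hv⟩ := Finite.exists_min f
  have hsum : ∀ s, ∑ t, (Q s t - ε) = 1 - Fintype.card S * ε := fun s => by
    rw [Finset.sum_sub_distrib, hs, Finset.sum_const, Finset.card_univ, nsmul_eq_mul]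
  -- The mass `ε` on every state contributes equally to both rows and drops out of the difference.
  have hexp : ∀ s, (Q.mulVec f) s = ∑ t, (Q s t - ε) * f t + ε * ∑ t, f t := fun s => by
    simp [Matrix.mulVec, dotProduct, sub_mul, Finset.sum_sub_distrib, Finset.mul_sum]
  have h1 : ∑ j, (Q s j - ε) * f j ≤ (1 - Fintype.card S * ε) * f u := by
    rw [← hsum s, Finset.sum_mul]
    exact Finset.sum_le_sum fun j _ => mul_le_mul_of_nonneg_left (hu j) (sub_nonneg.2 (hQ s j))
  have h2 : (1 - Fintype.card S * ε) * f v ≤ ∑ j, (Q t j - ε) * f j := by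
    rw [← hsum t, Finset.sum_mul]
    exact Finset.sum_le_sum fun j _ => mul_le_mul_of_nonneg_left (hv j) (sub_nonneg.2 (hQ t j))
  have h3 : 0 ≤ 1 - Fintype.card S * ε := by
    rw [← hsum s]
    exact Finset.sum_nonneg fun j _ => sub_nonneg.2 (hQ s j)
  have h4 := mul_le_mul_of_nonneg_left (hf u v) h3
  rw [hexp s, hexp t]
  linarith

/-- Convergence to equilibrium of an aperiodic irreducible finite Markov chain. -/
theorem tendsto_pow_mulVec {P : Matrix S S ℝ} (hP : ∀ s t, 0 ≤ P s t) (hs : ∀ s, ∑ t, P s t = 1)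
    (hd : ∀ s, 0 < P s s) (hc : ∀ s t, Relation.ReflTransGen (fun s t => 0 < P s t) s t)
    {w : S → ℝ} (hw : ∀ s, 0 ≤ w s) (hw' : 0 < ∑ s, w s)
    (hstat : Matrix.vecMul w P = w) (f : S → ℝ) (s : S) :
    Tendsto (fun n => ((P ^ n).mulVec f) s) atTop (𝓝 ((∑ t, w t * f t) / ∑ t, w t)) := by
  have : Nonempty S := ⟨s⟩
  obtain ⟨m, hm, hpos⟩ := exists_pow_pos hP hd hc
  obtain ⟨⟨u, v⟩, huv⟩ := Finite.exists_min fun p : S × S => (P ^ m) p.1 p.2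
  set ε := (P ^ m) u v with hε
  have hmin : ∀ s t, ε ≤ (P ^ m) s t := fun s t => huv (s, t)
  have hε0 : 0 < ε := hpos u v
  set κ : ℝ := 1 - Fintype.card S * ε with hκ
  have hκ0 : 0 ≤ κ := by
    have : ∑ _t : S, ε ≤ 1 := (Finset.sum_le_sum fun t _ => hmin s t).trans_eq (pow_row_sum hs m s)
    rw [Finset.sum_const, Finset.card_univ, nsmul_eq_mul] at this
    linarith
  have hκ1 : κ < 1 := by
    have : 0 < (Fintype.card S : ℝ) * ε := mul_pos (by exact_mod_cast Fintype.card_pos) hε0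
    linarith
  obtain ⟨D, hD⟩ : ∃ D, ∀ s t, f s - f t ≤ D := by
    obtain ⟨p, hp⟩ := Finite.exists_max fun p : S × S => f p.1 - f p.2
    exact ⟨_, fun s t => hp (s, t)⟩
  have hblock : ∀ k s t, ((P ^ (m * k)).mulVec f) s - ((P ^ (m * k)).mulVec f) t ≤ κ ^ k * D := by
    intro k
    induction k with
    | zero => intro s t; simpa using hD s t
    | succ k ih =>
      intro s t
      have := oscillation_contract hmin (pow_row_sum hs m) ih s t
      rw [Matrix.mulVec_mulVec, ← pow_add] at this
      rw [mul_add, mul_one, add_comm (m * k), pow_succ']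
      linarith
  -- The remaining `n % m` steps cannot increase the oscillation: this is the contraction bound with
  -- `ε = 0`.
  have hosc : ∀ n s t, ((P ^ n).mulVec f) s - ((P ^ n).mulVec f) t ≤ κ ^ (n / m) * D := by
    intro n s t
    have := oscillation_contract (fun s t => pow_nonneg_entries hP (n % m) s t)
      (pow_row_sum hs (n % m)) (hblock (n / m)) s t
    rw [Matrix.mulVec_mulVec, ← pow_add, Nat.mod_add_div] at this
    simpa using this
  have hpow : ∀ n, ∑ t, w t * ((P ^ n).mulVec f) t = ∑ t, w t * f t := by
    intro n
    have hst : ∀ n, Matrix.vecMul w (P ^ n) = w := by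
      intro n
      induction n with
      | zero => simp
      | succ n ih => rw [pow_succ, ← Matrix.vecMul_vecMul, ih, hstat]
    change w ⬝ᵥ ((P ^ n).mulVec f) = w ⬝ᵥ f
    rw [Matrix.dotProduct_mulVec, hst]
  -- By invariance the `w`-average of `P ^ n f` is already the claimed limit, so each entry differs
  -- from it by at most the oscillation.
  have hbound : ∀ n, |((P ^ n).mulVec f) s - (∑ t, w t * f t) / ∑ t, w t| ≤ κ ^ (n / m) * D := by
    intro n
    have hrw : ((P ^ n).mulVec f) s - (∑ t, w t * f t) / ∑ t, w t =
        (∑ t, w t * (((P ^ n).mulVec f) s - ((P ^ n).mulVec f) t)) / ∑ t, w t := by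
      simp_rw [mul_sub]
      rw [Finset.sum_sub_distrib, hpow, ← Finset.sum_mul]
      field_simp
    rw [hrw, abs_le, le_div_iff₀ hw', div_le_iff₀ hw', Finset.mul_sum, Finset.mul_sum]
    constructor
    · exact Finset.sum_le_sum fun t _ => by nlinarith [hosc n t s, hw t]
    · exact Finset.sum_le_sum fun t _ => by nlinarith [hosc n s t, hw t]
  rw [tendsto_iff_norm_sub_tendsto_zero]
  refine squeeze_zero (fun _ => norm_nonneg _) hbound ?_
  have h := (tendsto_pow_atTop_nhds_zero_of_lt_one hκ0 hκ1).comp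
    (Nat.tendsto_div_const_atTop hm.ne')
  simpa using h.mul_const D

end FiniteChain

/-! ### From the path measure to powers of the transition matrix -/

section PathLaw

variable {S : Type} [MeasurableSpace S] [DiscreteMeasurableSpace S]

instance (step : S → PMF S) (η : S) : IsProbabilityMeasure (chainLaw step η) := by
  unfold chainLaw; infer_instance

lemma chainLaw_map_zero (step : S → PMF S) (η : S) :
    (chainLaw step η).map (fun X => X 0) = Measure.dirac η := by
  have h := Kernel.traj_map_frestrictLe_apply (X := fun _ : ℕ => S)
    (κ := fun n => (stepKernel step).comap
      (fun past : (∀ _ : Finset.Iic n, S) => past ⟨n, Finset.mem_Iic.2 le_rfl⟩)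
      (measurable_pi_apply _)) 0 0 (fun _ => η)
  rw [Kernel.partialTraj_self, Kernel.id_apply] at h
  have h2 := congrArg (Measure.map fun x : (∀ _ : Finset.Iic 0, S) =>
    x ⟨0, Finset.mem_Iic.2 le_rfl⟩) h
  have hm : Measurable fun x : (∀ _ : Finset.Iic 0, S) => x ⟨0, Finset.mem_Iic.2 le_rfl⟩ :=
    measurable_pi_apply _
  rw [Measure.map_map hm (Preorder.measurable_frestrictLe 0), Measure.map_dirac' hm] at h2
  exact h2

/-- The Markov property for marginals: the transition kernel reads only the last coordinate of the
past, so the law up to time `n` enters only through its last marginal. -/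
lemma chainLaw_map_succ (step : S → PMF S) (η : S) (n : ℕ) :
    (chainLaw step η).map (fun X => X (n + 1)) =
      (stepKernel step) ∘ₘ ((chainLaw step η).map (fun X => X n)) := by
  set κ : ∀ n : ℕ, Kernel (∀ _ : Finset.Iic n, S) S := fun n => (stepKernel step).comap
      (fun past : (∀ _ : Finset.Iic n, S) => past ⟨n, Finset.mem_Iic.2 le_rfl⟩)
      (measurable_pi_apply _) with hκ
  have : ∀ n, IsMarkovKernel (κ n) := fun n => by rw [hκ]; infer_instance
  have h1 := Kernel.traj_comp_partialTraj (X := fun _ : ℕ => S) (κ := κ) (Nat.zero_le n)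
  have h2 := Kernel.map_traj_succ_self (X := fun _ : ℕ => S) (κ := κ) (a := n)
  have h3 := Kernel.traj_map_frestrictLe_apply (X := fun _ : ℕ => S) (κ := κ) 0 n (fun _ => η)
  have hl : chainLaw step η = Kernel.traj (X := fun _ : ℕ => S) κ 0 (fun _ => η) := rfl
  have hm : Measurable fun x : (∀ _ : Finset.Iic n, S) => x ⟨n, Finset.mem_Iic.2 le_rfl⟩ :=
    measurable_pi_apply _
  have hm' : Measurable fun x : ℕ → S => x (n + 1) := measurable_pi_apply _
  have h4 : (chainLaw step η).map (fun X => X n) = (Kernel.partialTraj (X := fun _ : ℕ => S) κ 0 n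
      (fun _ => η)).map (fun x => x ⟨n, Finset.mem_Iic.2 le_rfl⟩) := by
    rw [← h3, Measure.map_map hm (Preorder.measurable_frestrictLe n)]
    rfl
  rw [h4, hl, ← h1, Kernel.comp_apply, Measure.map_comp _ _ hm', h2]
  ext s hs
  rw [Measure.bind_apply hs (Kernel.aemeasurable _), Measure.bind_apply hs (Kernel.aemeasurable _),
    lintegral_map (Kernel.measurable_coe _ hs) hm]
  rfl

variable [Fintype S] [DecidableEq S]

lemma integral_chainLaw (step : S → PMF S) (η : S) (f : S → ℝ) (n : ℕ) :
    ∫ X, f (X n) ∂(chainLaw step η) = ((transitionMatrix step ^ n).mulVec f) η := by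
  have hm : ∀ (n : ℕ) (f : S → ℝ), ∫ X, f (X n) ∂(chainLaw step η) =
      ∫ s, f s ∂((chainLaw step η).map fun X => X n) := fun n f => by
    rw [integral_map (measurable_pi_apply n).aemeasurable
      (Measurable.of_discrete.aestronglyMeasurable)]
  induction n generalizing f with
  | zero => rw [hm, chainLaw_map_zero, integral_dirac]; simp
  | succ n ih =>
    have : IsProbabilityMeasure ((chainLaw step η).map fun X => X n) :=
      Measure.isProbabilityMeasure_map (measurable_pi_apply n).aemeasurable
    have hcomp := Kernel.integral_comp (η := stepKernel step)
      (κ := Kernel.const Unit ((chainLaw step η).map fun X => X n)) (a := ()) (f := f)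
      Integrable.of_finite
    rw [Kernel.comp_apply, Kernel.const_apply] at hcomp
    rw [hm, chainLaw_map_succ, pow_succ, ← Matrix.mulVec_mulVec, ← ih, hm n, hcomp]
    refine integral_congr_ae (ae_of_all _ fun s => ?_)
    exact (PMF.integral_eq_sum (step s) f).trans (by
      simp [Matrix.mulVec, dotProduct, transitionMatrix])

end PathLaw

/-! ### Invariance of the product weight -/

section Stationarity

lemma tsum_bind_mul {α β : Type} (p : PMF α) (q : α → PMF β) (f : β → ℝ≥0∞) :
    ∑' b, (p.bind q) b * f b = ∑' a, p a * ∑' b, q a b * f b := by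
  simp_rw [PMF.bind_apply, ← ENNReal.tsum_mul_right, ← ENNReal.tsum_mul_left, mul_assoc]
  exact ENNReal.tsum_comm

lemma tsum_map_mul {α β : Type} (p : PMF α) (h : α → β) (f : β → ℝ≥0∞) :
    ∑' b, (p.map h) b * f b = ∑' a, p a * f (h a) := by
  change ∑' b, (p.bind (PMF.pure ∘ h)) b * f b = _
  rw [tsum_bind_mul]
  refine tsum_congr fun a => ?_
  rw [tsum_eq_single (h a) fun b hb => by simp [hb]]
  simp

lemma Config.updateOn_apply {A : Type} [Fintype A] [DecidableEq A] {L : ℕ} (ξ : Config A L)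
    (B : Finset A) (v : B → ℕ) (hv : ∑ x, v x = ∑ x : B, ξ x) (z : A) :
    ξ.updateOn B v hv z = if h : z ∈ B then v ⟨z, h⟩ else ξ z := rfl

lemma Config.updateOn_coe {A : Type} [Fintype A] [DecidableEq A] {L : ℕ} (ξ : Config A L)
    (B : Finset A) (v : B → ℕ) (hv : ∑ x, v x = ∑ x : B, ξ x) (z : B) :
    ξ.updateOn B v hv z = v z := by
  rw [Config.updateOn_apply, dif_pos z.2]

lemma Config.updateOn_of_notMem {A : Type} [Fintype A] [DecidableEq A] {L : ℕ} (ξ : Config A L)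
    {B : Finset A} (v : B → ℕ) (hv : ∑ x, v x = ∑ x : B, ξ x) {z : A} (hz : z ∉ B) :
    ξ.updateOn B v hv z = ξ z := by
  rw [Config.updateOn_apply, dif_neg hz]

lemma Config.ext_on {A : Type} [Fintype A] {L : ℕ} {ξ η : Config A L} (B : Finset A)
    (h : ∀ z : B, ξ z = η z) (h' : ∀ z, z ∉ B → ξ z = η z) : ξ = η := by
  refine Subtype.ext (funext fun z => ?_)
  by_cases hz : z ∈ B
  · exact h ⟨z, hz⟩
  · exact h' z hz

variable {N L : ℕ}

/-- The unnormalised equilibrium weight `∏ x, G(ξ(x))`. -/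
noncomputable def weight (g : ℕ → ℝ≥0) (ξ : Config (Fin N) L) : ℝ≥0∞ := ∏ x, (G g (ξ x) : ℝ≥0∞)

/-- The weight of a configuration together with the coins picked by the agents in `A`. -/
noncomputable def jointWeight (g : ℕ → ℝ≥0) (A : Finset (Fin N)) (ξ : Config (Fin N) L)
    (c : A → ℕ) : ℝ≥0∞ := (∏ x ∈ Aᶜ, (G g (ξ x) : ℝ≥0∞)) * ∏ x : A, (g (c x) : ℝ≥0∞)

/-- Configurations together with admissible numbers of coins for the agents in `A`. -/
abbrev CoinChoice (N L : ℕ) (A : Finset (Fin N)) : Type :=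
  {p : Config (Fin N) L × (A → ℕ) // ∀ x : A, p.2 x ≤ p.1 x}

/-- Coin choices, together with a redistribution of the coins that are not saved. -/
abbrev SavingChoice (N L : ℕ) (A : Finset (Fin N)) : Type :=
  {p : Config (Fin N) L × (A → ℕ) × (A → ℕ) //
    (∀ x : A, p.2.1 x ≤ p.1 x) ∧ ∑ x, p.2.2 x = ∑ x : A, p.1 x - ∑ x, p.2.1 x}

variable (g : ℕ → ℝ≥0)

/-- The normalisers of the coin laws cancel the factors of the weight over `A`. -/
lemma weight_mul_indepLaw (hg : 0 < g 0) (A : Finset (Fin N)) (ξ : Config (Fin N) L)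
    (c : ∀ x : A, Fin (ξ x + 1)) :
    weight g ξ * indepLaw (fun x : A => coinLaw g hg (ξ x)) c =
      jointWeight g A ξ (fun x => c x) := by
  have h1 : indepLaw (fun x : A => coinLaw g hg (ξ x)) c =
      ∏ x : A, ((g (c x) / G g (ξ x) : ℝ≥0) : ℝ≥0∞) := rfl
  rw [h1, weight, jointWeight, ← Finset.prod_compl_mul_prod A, mul_assoc,
    ← Finset.prod_coe_sort A, ← Finset.prod_mul_distrib]
  congr 1
  refine Finset.prod_congr rfl fun x _ => ?_
  rw [← ENNReal.coe_mul, mul_div_cancel₀ _ (G_pos hg _).ne']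

/-- Admissible pairs of configurations and picks are gathered in one type, so that an update can act
on both components as a bijection. -/
lemma tsum_weight_mul_coins (hg : 0 < g 0) (A : Finset (Fin N)) (F : CoinChoice N L A → ℝ≥0∞) :
    ∑' ξ : Config (Fin N) L, weight g ξ *
      ∑' c, indepLaw (fun x : A => coinLaw g hg (ξ x)) c *
        F ⟨(ξ, fun x => c x), fun x => Nat.le_of_lt_succ (c x).2⟩ =
      ∑' p : CoinChoice N L A, jointWeight g A p.1.1 p.1.2 * F p := by
  let e : (Σ ξ : Config (Fin N) L, ∀ x : A, Fin (ξ x + 1)) ≃ CoinChoice N L A :=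
    { toFun := fun p => ⟨(p.1, fun x => p.2 x), fun x => Nat.le_of_lt_succ (p.2 x).2⟩
      invFun := fun p => ⟨p.1.1, fun x => ⟨p.1.2 x, Nat.lt_succ_of_le (p.2 x)⟩⟩
      left_inv := fun _ => rfl
      right_inv := fun _ => rfl }
  rw [← e.tsum_eq, ENNReal.tsum_sigma']
  refine tsum_congr fun ξ => ?_
  rw [← ENNReal.tsum_mul_left]
  refine tsum_congr fun c => ?_
  rw [← mul_assoc, weight_mul_indepLaw]
  rfl

lemma tsum_jointWeight_mul (hg : 0 < g 0) (A : Finset (Fin N)) (f : Config (Fin N) L → ℝ≥0∞) :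
    ∑' p : CoinChoice N L A, jointWeight g A p.1.1 p.1.2 * f p.1.1 =
      ∑' ξ, weight g ξ * f ξ := by
  rw [← tsum_weight_mul_coins g hg A fun p => f p.1.1]
  simp_rw [ENNReal.tsum_mul_right, PMF.tsum_coe, one_mul]

/-- The exchange of the picked coins according to the permutation `σ`. -/
def exchange (A : Finset (Fin N)) (σ : Equiv.Perm A) (p : CoinChoice N L A) : CoinChoice N L A :=
  ⟨(p.1.1.updateOn A (fun z => p.1.1 z - p.1.2 z + p.1.2 (σ⁻¹ z)) (by
      have h1 : ∑ z : A, p.1.2 (σ⁻¹ z) = ∑ z : A, p.1.2 z := Equiv.sum_comp σ⁻¹ p.1.2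
      rw [Finset.sum_add_distrib, h1, ← Finset.sum_add_distrib]
      exact Finset.sum_congr rfl fun z _ => Nat.sub_add_cancel (p.2 z)),
    fun z => p.1.2 (σ⁻¹ z)), fun z => by rw [Config.updateOn_coe]; exact Nat.le_add_left _ _⟩

/-- An exchange records the coins received as the new picks, so sending these back along `σ⁻¹`
restores the holdings. -/
lemma exchange_exchange (A : Finset (Fin N)) (σ : Equiv.Perm A) (p : CoinChoice N L A) :
    exchange A σ⁻¹ (exchange A σ p) = p := by
  refine Subtype.ext (Prod.ext (Config.ext_on A (fun z => ?_) fun z hz => ?_) (funext fun z => ?_))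
  · simp only [exchange, Config.updateOn_coe]
    have := p.2 z
    simp only [inv_inv, ← Equiv.Perm.mul_apply, inv_mul_cancel, Equiv.Perm.one_apply]
    omega
  · simp only [exchange, Config.updateOn_of_notMem _ _ _ hz]
  · simp [exchange]

/-- Outside `A` nothing changes, and on `A` the factors `g(c(x))` are merely permuted. -/
lemma jointWeight_exchange (A : Finset (Fin N)) (σ : Equiv.Perm A) (p : CoinChoice N L A) :
    jointWeight g A (exchange A σ p).1.1 (exchange A σ p).1.2 = jointWeight g A p.1.1 p.1.2 := by
  unfold jointWeight
  congr 1
  · exact Finset.prod_congr rfl fun x hx => by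
      simp only [exchange, Config.updateOn_of_notMem _ _ _ (Finset.mem_compl.1 hx)]
  · exact Equiv.prod_comp σ⁻¹ fun x => (g (p.1.2 x) : ℝ≥0∞)

/-- The redistribution of the coins that are not saved. -/
def redistribute (A : Finset (Fin N)) (p : SavingChoice N L A) : SavingChoice N L A :=
  have hd : ∑ z : A, (p.1.2.1 z + p.1.2.2 z) = ∑ z : A, p.1.1 z := by
    rw [Finset.sum_add_distrib, p.2.2]
    exact Nat.add_sub_cancel' (Finset.sum_le_sum fun z _ => p.2.1 z)
  ⟨(p.1.1.updateOn A (fun z => p.1.2.1 z + p.1.2.2 z) hd, p.1.2.1,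
      fun z => p.1.1 z - p.1.2.1 z), by
    refine ⟨fun z => ?_, ?_⟩
    · rw [Config.updateOn_coe]; exact Nat.le_add_right _ _
    · simp_rw [Config.updateOn_coe]
      rw [hd, Finset.sum_tsub_distrib _ fun z _ => p.2.1 z]⟩

/-- The new last component records the coins `ξ - c` that had not been saved, so a second
application hands them back. -/
lemma redistribute_redistribute (A : Finset (Fin N)) (p : SavingChoice N L A) :
    redistribute A (redistribute A p) = p := by
  refine Subtype.ext (Prod.ext (Config.ext_on A (fun z => ?_) fun z hz => ?_)
    (Prod.ext rfl (funext fun z => ?_)))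
  · simp only [redistribute, Config.updateOn_coe]
    exact Nat.add_sub_cancel' (p.2.1 z)
  · simp only [redistribute, Config.updateOn_of_notMem _ _ _ hz]
  · simp [redistribute, Config.updateOn_coe]

/-- The density of the uniform redistribution depends only on the size of the pool, which is why it
survives the swap. -/
lemma sum_redistribute (A : Finset (Fin N)) (p : SavingChoice N L A) :
    ∑ x, (redistribute A p).1.2.2 x = ∑ x, p.1.2.2 x := by
  rw [p.2.2]
  exact Finset.sum_tsub_distrib _ fun z _ => p.2.1 z

lemma jointWeight_redistribute (A : Finset (Fin N)) (p : SavingChoice N L A) :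
    jointWeight g A (redistribute A p).1.1 (redistribute A p).1.2.1 =
      jointWeight g A p.1.1 p.1.2.1 := by
  unfold jointWeight
  congr 1
  exact Finset.prod_congr rfl fun x hx => by
    simp only [redistribute, Config.updateOn_of_notMem _ _ _ (Finset.mem_compl.1 hx)]

/-- A mixture over `A` preserves the weight if the step with each fixed `A` does. -/
lemma tsum_weight_mul_bind (ρ : PMF (ExchangeSet N))
    (q : Config (Fin N) L → ExchangeSet N → PMF (Config (Fin N) L)) (f : Config (Fin N) L → ℝ≥0∞)
    (h : ∀ A, ∑' ξ, weight g ξ * ∑' η, q ξ A η * f η = ∑' ξ, weight g ξ * f ξ) :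
    ∑' ξ, weight g ξ * ∑' η, (ρ.bind (q ξ)) η * f η = ∑' ξ, weight g ξ * f ξ := by
  simp_rw [tsum_bind_mul, ← ENNReal.tsum_mul_left]
  rw [ENNReal.tsum_comm]
  have : ∀ A, ∑' ξ, ∑' η, weight g ξ * (ρ A * (q ξ A η * f η)) =
      ρ A * ∑' ξ, weight g ξ * f ξ := fun A => by
    rw [← h A, ← ENNReal.tsum_mul_left]
    refine tsum_congr fun ξ => ?_
    simp_rw [← ENNReal.tsum_mul_left, mul_left_comm]
  simp_rw [← ENNReal.tsum_mul_left] at this ⊢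
  rw [tsum_congr this]
  simp_rw [ENNReal.tsum_mul_left]
  rw [ENNReal.tsum_mul_right, ρ.tsum_coe, one_mul]

theorem tsum_weight_mul_immediateExchange (hg : 0 < g 0) (ρ : PMF (ExchangeSet N))
    (f : Config (Fin N) L → ℝ≥0∞) :
    ∑' ξ, weight g ξ * ∑' η, immediateExchange g hg ρ ξ η * f η = ∑' ξ, weight g ξ * f ξ := by
  refine tsum_weight_mul_bind g ρ _ f fun A => ?_
  simp_rw [tsum_bind_mul, tsum_map_mul]
  refine (tsum_weight_mul_coins g hg A.1 fun p =>
    ∑' σ, PMF.uniformOfFintype (Equiv.Perm A.1) σ * f (exchange A.1 σ p).1.1).trans ?_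
  simp_rw [← ENNReal.tsum_mul_left]
  rw [ENNReal.tsum_comm]
  have : ∀ σ : Equiv.Perm A.1, ∑' p : CoinChoice N L A.1, jointWeight g A.1 p.1.1 p.1.2 *
      (PMF.uniformOfFintype (Equiv.Perm A.1) σ * f (exchange A.1 σ p).1.1) =
      PMF.uniformOfFintype (Equiv.Perm A.1) σ * ∑' ξ, weight g ξ * f ξ := fun σ => by
    let e : CoinChoice N L A.1 ≃ CoinChoice N L A.1 :=
      { toFun := exchange A.1 σ
        invFun := exchange A.1 σ⁻¹
        left_inv := exchange_exchange A.1 σ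
        right_inv := fun p => by simpa using exchange_exchange A.1 σ⁻¹ p }
    rw [← tsum_jointWeight_mul g hg A.1,
      ← e.tsum_eq fun p : CoinChoice N L A.1 => jointWeight g A.1 p.1.1 p.1.2 * f p.1.1,
      ← ENNReal.tsum_mul_left]
    refine tsum_congr fun p => ?_
    rw [← jointWeight_exchange g A.1 σ p, mul_left_comm]
    rfl
  rw [tsum_congr this, ENNReal.tsum_mul_right, PMF.tsum_coe, one_mul]

theorem tsum_weight_mul_randomSaving (hg : 0 < g 0) (ρ : PMF (ExchangeSet N))
    (f : Config (Fin N) L → ℝ≥0∞) :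
    ∑' ξ, weight g ξ * ∑' η, randomSaving g hg ρ ξ η * f η = ∑' ξ, weight g ξ * f ξ := by
  refine tsum_weight_mul_bind g ρ _ f fun A => ?_
  simp_rw [tsum_bind_mul, tsum_map_mul]
  let u : ℕ → ℝ≥0∞ := fun m => (Fintype.card (Config A.1 m) : ℝ≥0∞)⁻¹
  let e : (Σ p : CoinChoice N L A.1, Config A.1 (∑ x : A.1, p.1.1 x - ∑ x, p.1.2 x)) ≃
      SavingChoice N L A.1 :=
    { toFun := fun p => ⟨(p.1.1.1, p.1.1.2, p.2.1), p.1.2, p.2.2⟩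
      invFun := fun p => ⟨⟨(p.1.1, p.1.2.1), p.2.1⟩, ⟨p.1.2.2, p.2.2⟩⟩
      left_inv := fun _ => rfl
      right_inv := fun _ => rfl }
  let r : SavingChoice N L A.1 ≃ SavingChoice N L A.1 :=
    { toFun := redistribute A.1
      invFun := redistribute A.1
      left_inv := redistribute_redistribute A.1
      right_inv := redistribute_redistribute A.1 }
  have hsum : ∀ F : SavingChoice N L A.1 → ℝ≥0∞,
      ∑' p : CoinChoice N L A.1, jointWeight g A.1 p.1.1 p.1.2 *
        ∑' d, PMF.uniformOfFintype (Config A.1 (∑ x : A.1, p.1.1 x - ∑ x, p.1.2 x)) d *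
          F (e ⟨p, d⟩) =
      ∑' p : SavingChoice N L A.1, jointWeight g A.1 p.1.1 p.1.2.1 * (u (∑ x, p.1.2.2 x) * F p) :=
    fun F => by
      rw [← e.tsum_eq, ENNReal.tsum_sigma']
      refine tsum_congr fun p => ?_
      rw [← ENNReal.tsum_mul_left]
      refine tsum_congr fun d => ?_
      have hd : ∑ x, (e ⟨p, d⟩).1.2.2 x = ∑ x : A.1, p.1.1 x - ∑ x, p.1.2 x := d.2
      rw [hd, PMF.uniformOfFintype_apply]
      rfl
  refine (tsum_weight_mul_coins g hg A.1 fun p => ∑' d, PMF.uniformOfFintype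
    (Config A.1 (∑ x : A.1, p.1.1 x - ∑ x, p.1.2 x)) d * f (r (e ⟨p, d⟩)).1.1).trans ?_
  rw [hsum fun q => f (r q).1.1]
  have hr : ∑' p, jointWeight g A.1 (r p).1.1 (r p).1.2.1 *
      (u (∑ x, (r p).1.2.2 x) * f (r p).1.1) = _ := r.tsum_eq fun p : SavingChoice N L A.1 =>
    jointWeight g A.1 p.1.1 p.1.2.1 * (u (∑ x, p.1.2.2 x) * f p.1.1)
  have hr' : ∀ p, jointWeight g A.1 (r p).1.1 (r p).1.2.1 *
      (u (∑ x, (r p).1.2.2 x) * f (r p).1.1) =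
      jointWeight g A.1 p.1.1 p.1.2.1 * (u (∑ x, p.1.2.2 x) * f (r p).1.1) := fun p => by
    rw [← jointWeight_redistribute g A.1 p, ← sum_redistribute A.1 p]
    rfl
  simp_rw [hr'] at hr
  rw [hr, ← hsum fun q => f q.1.1, ← tsum_jointWeight_mul g hg A.1]
  refine tsum_congr fun p => ?_
  change _ * ∑' d, PMF.uniformOfFintype
    (Config A.1 (∑ x : A.1, p.1.1 x - ∑ x, p.1.2 x)) d * f p.1.1 = _
  rw [ENNReal.tsum_mul_right, PMF.tsum_coe, one_mul]

end Stationarity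

/-! ### Irreducibility by moving single coins -/

section Irreducibility

variable {N L : ℕ}

/-- `ξ'` arises from `ξ` when `u` hands one coin to `v`. -/
def CoinMove (u v : Fin N) (ξ ξ' : Config (Fin N) L) : Prop :=
  ∀ x, ξ' x + (if x = u then 1 else 0) = ξ x + (if x = v then 1 else 0)

lemma CoinMove.refl (u : Fin N) (ξ : Config (Fin N) L) : CoinMove u u ξ ξ := fun _ => rfl

lemma CoinMove.eq_of_same {u : Fin N} {ξ ξ' : Config (Fin N) L} (h : CoinMove u u ξ ξ') :
    ξ' = ξ :=
  Subtype.ext (funext fun x => Nat.add_right_cancel (h x))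

lemma CoinMove.eq_off {u v : Fin N} {ξ ξ' : Config (Fin N) L} (h : CoinMove u v ξ ξ')
    {x : Fin N} (hu : x ≠ u) (hv : x ≠ v) : ξ' x = ξ x := by
  simpa [hu, hv] using h x

lemma exists_coinMove {u : Fin N} (v : Fin N) {ξ : Config (Fin N) L} (hu : 0 < ξ u) :
    ∃ ξ', CoinMove u v ξ ξ' := by
  have h : ∀ x, (ξ x - (if x = u then 1 else 0) + if x = v then 1 else 0) +
      (if x = u then 1 else 0) = ξ x + (if x = v then 1 else 0) := by
    intro x
    by_cases hx : x = u
    · subst hx; simp only [if_true]; omega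
    · simp [hx]
  refine ⟨⟨fun x => ξ x - (if x = u then 1 else 0) + (if x = v then 1 else 0), ?_⟩, h⟩
  have := Finset.sum_congr (rfl : (Finset.univ : Finset (Fin N)) = _) fun x _ => h x
  simp only [Finset.sum_add_distrib, Finset.sum_ite_eq', Finset.mem_univ, if_true, ξ.2] at this
  simp only [Finset.sum_add_distrib, Finset.sum_ite_eq', Finset.mem_univ, if_true]
  omega

/-- A chain in which any two agents of a hyperedge can exchange single coins. -/
def AllowsCoinMoves (ρ : PMF (ExchangeSet N))
    (step : Config (Fin N) L → PMF (Config (Fin N) L)) : Prop :=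
  ∀ A : ExchangeSet N, 0 < ρ A → ∀ u ∈ A.1, ∀ v ∈ A.1, ∀ ξ ξ', CoinMove u v ξ ξ' → 0 < step ξ ξ'

/-- A move with `u = v` changes nothing; this gives aperiodicity. -/
lemma AllowsCoinMoves.diag_pos {ρ : PMF (ExchangeSet N)}
    {step : Config (Fin N) L → PMF (Config (Fin N) L)} (h : AllowsCoinMoves ρ step)
    (ξ : Config (Fin N) L) : 0 < step ξ ξ := by
  obtain ⟨A, hA⟩ := ρ.support_nonempty
  obtain ⟨u⟩ := (inferInstance : Nonempty A.1)
  exact h A ((PMF.apply_pos_iff _ _).2 hA) u u.2 u u.2 ξ ξ (CoinMove.refl _ _)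

/-- The coin is carried from `u` along a chain of intersecting hyperedges, one hyperedge per step.
-/
lemma AllowsCoinMoves.reach_coinMove {ρ : PMF (ExchangeSet N)} (hρ : HypergraphConnected ρ)
    {step : Config (Fin N) L → PMF (Config (Fin N) L)} (h : AllowsCoinMoves ρ step) (u v : Fin N)
    (ξ ξ' : Config (Fin N) L) (hm : CoinMove u v ξ ξ') :
    Relation.ReflTransGen (fun s t => 0 < step s t) ξ ξ' := by
  induction hρ u v generalizing ξ' with
  | refl => rw [hm.eq_of_same]
  | @tail m v _ hmv ih =>
    by_cases huv : u = v
    · subst huv; rw [hm.eq_of_same]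
    obtain ⟨A, hA, hmA, hvA⟩ := hmv
    have hu : 0 < ξ u := by
      have := hm u
      simp only [if_true, if_neg huv] at this
      omega
    obtain ⟨ζ, hζ⟩ := exists_coinMove m hu
    refine (ih ζ hζ).tail (h A hA m hmA v hvA ζ ξ' fun x => ?_)
    have h1 := hm x
    have h2 := hζ x
    omega

theorem AllowsCoinMoves.reach {ρ : PMF (ExchangeSet N)} (hρ : HypergraphConnected ρ)
    {step : Config (Fin N) L → PMF (Config (Fin N) L)} (h : AllowsCoinMoves ρ step)
    (ξ η : Config (Fin N) L) : Relation.ReflTransGen (fun s t => 0 < step s t) ξ η := by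
  -- With truncated subtraction the sum counts the coins held in excess of the target; a move from
  -- an agent with excess to one with a deficit lowers it.
  induction hn : ∑ x, (ξ x - η x) using Nat.strong_induction_on generalizing ξ with
  | _ n ih =>
    by_cases hle : ∀ x, ξ x ≤ η x
    · have heq : ∀ x ∈ Finset.univ, ξ x = η x :=
        (Finset.sum_eq_sum_iff_of_le fun x _ => hle x).1 (ξ.2.trans η.2.symm)
      rw [show ξ = η from Subtype.ext (funext fun x => heq x (Finset.mem_univ x))]
    · push Not at hle
      obtain ⟨u, hu⟩ := hle
      obtain ⟨v, hv⟩ : ∃ v, ξ v < η v := by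
        by_contra! hge
        have := Finset.sum_lt_sum (fun x _ => hge x) ⟨u, Finset.mem_univ u, hu⟩
        rw [ξ.2, η.2] at this
        exact lt_irrefl _ this
      have huv : u ≠ v := fun h => by subst h; omega
      obtain ⟨ζ, hζ⟩ := exists_coinMove v (ξ := ξ) (u := u) (by omega)
      refine (h.reach_coinMove hρ u v ξ ζ hζ).trans (ih _ ?_ ζ rfl)
      rw [← hn]
      refine Finset.sum_lt_sum (fun x _ => ?_) ⟨u, Finset.mem_univ u, ?_⟩
      · have := hζ x
        by_cases hxv : x = v
        · subst hxv
          simp only [if_true, if_neg huv.symm] at this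
          omega
        · simp only [if_neg hxv] at this
          omega
      · have := hζ u
        simp only [if_true, if_neg huv] at this
        omega

lemma coinLaw_pos {g : ℕ → ℝ≥0} (hg : 0 < g 0) {k : ℕ} {j : Fin (k + 1)} (hj : 0 < g j) :
    0 < coinLaw g hg k j := by
  change (0 : ℝ≥0∞) < ((g j / G g k : ℝ≥0) : ℝ≥0∞)
  exact_mod_cast div_pos hj (G_pos hg k)

lemma indepLaw_pos {ι : Type} [Fintype ι] [DecidableEq ι] {β : ι → Type}
    [∀ i, Fintype (β i)] {p : ∀ i, PMF (β i)} {c : ∀ i, β i} (h : ∀ i, 0 < p i (c i)) :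
    0 < indepLaw p c := by
  change 0 < ∏ i, p i (c i)
  exact pos_iff_ne_zero.2 (Finset.prod_ne_zero_iff.2 fun i _ => (h i).ne')

variable {g : ℕ → ℝ≥0}

/-- Agent `u` picks one coin, the others pick none, and `σ` swaps `u` with `v`. This is where `g(1)
> 0` enters. -/
theorem allowsCoinMoves_immediateExchange (hg : 0 < g 0) (hg1 : 0 < g 1) (ρ : PMF (ExchangeSet N)) :
    AllowsCoinMoves (L := L) ρ (immediateExchange g hg ρ) := by
  intro A hA u hu v hv ξ ξ' hm
  have hex : ∃ (c : ∀ x : A.1, Fin (ξ x + 1)) (σ : Equiv.Perm A.1),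
      (∀ x, 0 < g (c x)) ∧ ∀ z : A.1, ξ z - (c z : ℕ) + (c (σ⁻¹ z) : ℕ) = ξ' z := by
    by_cases huv : u = v
    · subst huv
      rw [hm.eq_of_same]
      exact ⟨fun _ => 0, 1, fun _ => by simpa using hg, fun z => by simp⟩
    · have hxu : 0 < ξ u := by
        have := hm u
        simp only [if_true, if_neg huv] at this
        omega
      refine ⟨fun x => ⟨if (x : Fin N) = u then 1 else 0, ?_⟩, Equiv.swap ⟨u, hu⟩ ⟨v, hv⟩,
        fun x => ?_, fun z => ?_⟩
      · split_ifs with h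
        · rw [h]; omega
        · omega
      · dsimp only
        split_ifs
        exacts [hg1, hg]
      · have h1 := hm z
        have h2 : (((Equiv.swap ⟨u, hu⟩ ⟨v, hv⟩ : Equiv.Perm A.1)⁻¹ z : A.1) : Fin N) = u ↔
            (z : Fin N) = v := by
          rw [Equiv.swap_inv]
          constructor
          · intro h
            have h' : Equiv.swap ⟨u, hu⟩ ⟨v, hv⟩ z = (⟨u, hu⟩ : A.1) := Subtype.ext h
            rw [Equiv.swap_apply_eq_iff, Equiv.swap_apply_left] at h'
            rw [h']
          · intro h
            rw [show z = ⟨v, hv⟩ from Subtype.ext h, Equiv.swap_apply_right]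
        simp only [h2]
        by_cases hzu : (z : Fin N) = u
        · rw [if_pos hzu] at h1 ⊢
          rw [hzu] at h1 ⊢
          omega
        · rw [if_neg hzu] at h1 ⊢
          omega
  obtain ⟨c, σ, hc, hcσ⟩ := hex
  rw [PMF.apply_pos_iff]
  refine (PMF.mem_support_bind_iff _ _ _).2 ⟨A, (PMF.apply_pos_iff _ _).1 hA, ?_⟩
  refine (PMF.mem_support_bind_iff _ _ _).2 ⟨c, (PMF.apply_pos_iff _ _).1
    (indepLaw_pos fun x => coinLaw_pos hg (hc x)), ?_⟩
  refine (PMF.mem_support_map_iff _ _ _).2 ⟨σ, PMF.mem_support_uniformOfFintype _, ?_⟩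
  refine Config.ext_on A.1 (fun z => ?_) fun z hz => ?_
  · rw [Config.updateOn_coe, hcσ]
  · rw [Config.updateOn_of_notMem _ _ _ hz,
      hm.eq_off (x := z) (fun h => hz (h ▸ hu)) fun h => hz (h ▸ hv)]

/-- Nobody saves anything and the redistribution is the target itself, so `g(0) > 0` suffices. -/
theorem allowsCoinMoves_randomSaving (hg : 0 < g 0) (ρ : PMF (ExchangeSet N)) :
    AllowsCoinMoves (L := L) ρ (randomSaving g hg ρ) := by
  intro A hA u hu v hv ξ ξ' hm
  have hoff : ∀ z, z ∉ A.1 → ξ' z = ξ z := fun z hz =>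
    hm.eq_off (fun h => hz (h ▸ hu)) fun h => hz (h ▸ hv)
  rw [PMF.apply_pos_iff]
  refine (PMF.mem_support_bind_iff _ _ _).2 ⟨A, (PMF.apply_pos_iff _ _).1 hA, ?_⟩
  refine (PMF.mem_support_bind_iff _ _ _).2 ⟨fun _ => 0, (PMF.apply_pos_iff _ _).1
    (indepLaw_pos fun x => coinLaw_pos hg (by simpa using hg)), ?_⟩
  refine (PMF.mem_support_map_iff _ _ _).2 ⟨⟨fun z => ξ' z, ?_⟩,
    PMF.mem_support_uniformOfFintype _, ?_⟩
  · have h1 := (Finset.sum_add_sum_compl A.1 ξ'.1).trans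
      (ξ'.2.trans (ξ.2.symm.trans (Finset.sum_add_sum_compl A.1 ξ.1).symm))
    rw [Finset.sum_congr rfl fun z hz => hoff z (Finset.mem_compl.1 hz)] at h1
    have h2 := Nat.add_right_cancel h1
    rw [← Finset.sum_coe_sort A.1, ← Finset.sum_coe_sort A.1] at h2
    simpa using h2
  · refine Config.ext_on A.1 (fun z => ?_) fun z hz => ?_
    · rw [Config.updateOn_coe]; simp
    · rw [Config.updateOn_of_notMem _ _ _ hz, hoff z hz]

/-- The expected fraction converges to its value at equilibrium. -/
theorem tendsto_expectedFraction (hg : 0 < g 0) {ρ : PMF (ExchangeSet N)} (hρ : HypergraphConnected ρ)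
    {step : Config (Fin N) L → PMF (Config (Fin N) L)} (h : AllowsCoinMoves ρ step)
    (hstat : ∀ f : Config (Fin N) L → ℝ≥0∞,
      ∑' ξ, weight g ξ * ∑' η, step ξ η * f η = ∑' ξ, weight g ξ * f ξ)
    (a : ℝ) (I : Set ℝ) (η : Config (Fin N) L) :
    Tendsto (fun n => expectedFraction step η a I n) atTop
      (𝓝 ((∑ ξ : Config (Fin N) L, (∏ x, (G g (ξ x) : ℝ)) *
          ((1 / (N : ℝ)) * ({x : Fin N | 1 / a * (ξ x : ℝ) ∈ I}.ncard : ℝ))) /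
        ∑ ξ : Config (Fin N) L, ∏ x, (G g (ξ x) : ℝ))) := by
  classical
  have hw : ∀ ξ : Config (Fin N) L, (weight g ξ).toReal = ∏ x, (G g (ξ x) : ℝ) := fun ξ => by
    rw [weight, ENNReal.toReal_prod]; rfl
  have hpos : ∀ ξ : Config (Fin N) L, 0 < ∏ x, (G g (ξ x) : ℝ) := fun ξ =>
    Finset.prod_pos fun x _ => by exact_mod_cast G_pos hg _
  have : Nonempty (Config (Fin N) L) := ⟨η⟩
  unfold expectedFraction
  simp_rw [fun n => integral_chainLaw step η
    (fun ξ => (1 / (N : ℝ)) * ({x : Fin N | 1 / a * (ξ x : ℝ) ∈ I}.ncard : ℝ)) n]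
  refine tendsto_pow_mulVec (transitionMatrix_nonneg step) (sum_transitionMatrix step)
    (fun s => transitionMatrix_pos (h.diag_pos s))
    (fun s t => Relation.ReflTransGen.mono (fun _ _ => transitionMatrix_pos) s t (h.reach hρ s t))
    (w := fun ξ : Config (Fin N) L => ∏ x, (G g (ξ x) : ℝ)) (fun ξ => (hpos ξ).le)
    (Finset.sum_pos (fun ξ _ => hpos ξ) Finset.univ_nonempty) ?_ _ η
  funext ζ
  -- Testing against the indicator of `ζ` gives the `ζ`-coordinate of the invariance equation.
  have h1 := hstat (Pi.single ζ 1)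
  rw [tsum_fintype, tsum_fintype] at h1
  simp_rw [tsum_fintype] at h1
  simp only [Pi.single_apply, mul_ite, mul_one, mul_zero, Finset.sum_ite_eq', Finset.mem_univ,
    if_true] at h1
  rw [← hw ζ, ← h1, ENNReal.toReal_sum]
  · simp only [Matrix.vecMul, dotProduct, ENNReal.toReal_mul, hw, transitionMatrix]
  · intro ξ _
    refine ENNReal.mul_ne_top ?_ ((step ξ).apply_ne_top ζ)
    exact ENNReal.prod_ne_top fun x _ => ENNReal.coe_ne_top

end Irreducibility

/-! ### Convolution powers and exponential tilts -/

/-- The `N`-fold convolution power of the sequence `u`. -/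
noncomputable def convPow (u : ℕ → ℝ) : ℕ → ℕ → ℝ
  | 0, L => if L = 0 then 1 else 0
  | N + 1, L => ∑ p ∈ Finset.HasAntidiagonal.antidiagonal L, u p.1 * convPow u N p.2

lemma sum_antidiagonalTuple_prod (u : ℕ → ℝ) (N L : ℕ) :
    ∑ η ∈ Finset.Nat.antidiagonalTuple N L, ∏ x, u (η x) = convPow u N L := by
  induction N generalizing L with
  | zero =>
    cases L with
    | zero => simp [convPow]
    | succ L => simp [convPow]
  | succ N ih =>
    simp only [convPow, ← ih, Finset.mul_sum]
    rw [Finset.sum_sigma']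
    refine Finset.sum_bij' (fun η _ => ⟨(η 0, ∑ x : Fin N, η x.succ), fun x => η x.succ⟩)
      (fun p _ => Fin.cons p.1.1 p.2) ?_ ?_ ?_ ?_ ?_
    · intro η hη
      rw [Finset.Nat.mem_antidiagonalTuple, Fin.sum_univ_succ] at hη
      simp [Finset.Nat.mem_antidiagonalTuple, hη]
    · rintro ⟨⟨k, l⟩, η⟩ hp
      simp only [Finset.mem_sigma, Finset.HasAntidiagonal.mem_antidiagonal,
        Finset.Nat.mem_antidiagonalTuple] at hp
      rw [Finset.Nat.mem_antidiagonalTuple, Fin.sum_univ_succ]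
      simp [hp.1, hp.2]
    · intro η _
      exact Fin.cons_self_tail η
    · rintro ⟨⟨k, l⟩, η⟩ hp
      simp only [Finset.mem_sigma, Finset.HasAntidiagonal.mem_antidiagonal,
        Finset.Nat.mem_antidiagonalTuple] at hp
      simp [hp.2]
    · intro η _
      rw [Fin.prod_univ_succ]

lemma sum_config_prod (u : ℕ → ℝ) (N L : ℕ) :
    ∑ η : Config (Fin N) L, ∏ x, u (η x) = convPow u N L := by
  rw [← sum_antidiagonalTuple_prod]
  refine Finset.sum_bij (fun η _ => η.1) (fun η _ => Finset.Nat.mem_antidiagonalTuple.2 η.2)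
    (fun _ _ _ _ h => Subtype.ext h)
    (fun η h => ⟨⟨η, Finset.Nat.mem_antidiagonalTuple.1 h⟩, Finset.mem_univ _, rfl⟩)
    fun _ _ => rfl

lemma convPow_nonneg {u : ℕ → ℝ} (hu : ∀ k, 0 ≤ u k) (N L : ℕ) : 0 ≤ convPow u N L := by
  induction N generalizing L with
  | zero => unfold convPow; split_ifs <;> norm_num
  | succ N ih =>
    unfold convPow
    exact Finset.sum_nonneg fun p _ => mul_nonneg (hu _) (ih _)

lemma convPow_mul_exp (u : ℕ → ℝ) (s : ℝ) (N L : ℕ) :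
    convPow (fun k => u k * Real.exp (-(s * k))) N L = convPow u N L * Real.exp (-(s * L)) := by
  induction N generalizing L with
  | zero =>
    unfold convPow
    split_ifs with h
    · simp [h]
    · simp
  | succ N ih =>
    unfold convPow
    rw [Finset.sum_mul]
    refine Finset.sum_congr rfl fun p hp => ?_
    rw [ih, ← Finset.HasAntidiagonal.mem_antidiagonal.1 hp, Nat.cast_add, mul_add, neg_add, Real.exp_add]
    ring

/-- Giving one extra coin to the first agent maps the configurations of total `L` injectively to
those of total `L + 1` and does not lower the weight. At least one factor is needed: the empty
product is supported at `0`. -/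
lemma convPow_succ_le_of_monotone {u : ℕ → ℝ} (hu : ∀ k, 0 ≤ u k) (hmono : Monotone u)
    (N : ℕ) : Monotone (convPow u (N + 1)) := by
  refine monotone_nat_of_le_succ fun L => ?_
  simp only [convPow]
  rw [Finset.Nat.sum_antidiagonal_succ]
  refine le_add_of_nonneg_of_le (mul_nonneg (hu _) (convPow_nonneg hu _ _)) ?_
  exact Finset.sum_le_sum fun p _ =>
    mul_le_mul_of_nonneg_right (hmono (Nat.le_succ _)) (convPow_nonneg hu _ _)

lemma hasSum_convPow {u : ℕ → ℝ} (hu : ∀ k, 0 ≤ u k) (hs : Summable u) (N : ℕ) :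
    HasSum (convPow u N) ((∑' k, u k) ^ N) := by
  induction N with
  | zero =>
    rw [pow_zero]
    exact hasSum_ite_eq 0 1
  | succ N ih =>
    have hprod := hs.mul_of_nonneg ih.summable hu (convPow_nonneg hu N)
    have h := hs.tsum_mul_tsum_eq_tsum_sum_antidiagonal ih.summable hprod
    rw [ih.tsum_eq, ← pow_succ'] at h
    rw [h]
    exact (summable_sum_mul_antidiagonal_of_summable_mul hprod).hasSum

/-- All coordinates but one are summed freely; the last is fixed by the total and bounded by `B`.
The spare factor `B` matters later, when it is small compared with the sum. -/
lemma convPow_succ_le {u : ℕ → ℝ} (hu : ∀ k, 0 ≤ u k) (hs : Summable u) {B : ℝ}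
    (hB : ∀ k, u k ≤ B) (N L : ℕ) : convPow u (N + 1) L ≤ B * (∑' k, u k) ^ N := by
  induction N generalizing L with
  | zero =>
    rw [pow_zero, mul_one]
    refine le_trans (le_of_eq ?_) (hB L)
    simp only [convPow]
    rw [Finset.sum_eq_single (L, 0)]
    · simp
    · rintro ⟨k, l⟩ hp hne
      have : l ≠ 0 := by
        rintro rfl
        exact hne (by simpa using hp)
      simp [this]
    · simp
  | succ N ih =>
    rw [convPow]
    have hW : 0 ≤ B * (∑' k, u k) ^ N :=
      mul_nonneg ((hu 0).trans (hB 0)) (pow_nonneg (tsum_nonneg hu) N)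
    calc ∑ p ∈ Finset.HasAntidiagonal.antidiagonal L, u p.1 * convPow u (N + 1) p.2
        ≤ ∑ p ∈ Finset.HasAntidiagonal.antidiagonal L, u p.1 * (B * (∑' k, u k) ^ N) :=
          Finset.sum_le_sum fun p _ => mul_le_mul_of_nonneg_left (ih _) (hu _)
      _ = (∑ k ∈ Finset.range (L + 1), u k) * (B * (∑' k, u k) ^ N) := by
          rw [← Finset.sum_mul, Finset.Nat.sum_antidiagonal_eq_sum_range_succ_mk]
      _ ≤ (∑' k, u k) * (B * (∑' k, u k) ^ N) :=
          mul_le_mul_of_nonneg_right (hs.sum_le_tsum _ fun k _ => hu k) hW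
      _ = B * (∑' k, u k) ^ (N + 1) := by ring

/-! ### Regular variation, uniform bounds and Riemann sums -/

/-- The map `r ↦ ⌊r * a⌋₊` pushes Lebesgue measure on the half-line to `1 / a` times counting
measure, so a series is exactly an integral and dominated convergence applies. -/
lemma hasSum_of_integrableOn_floor {a : ℝ} (ha : 0 < a) {H : ℕ → ℝ}
    (hH : IntegrableOn (fun r : ℝ => H ⌊r * a⌋₊) (Set.Ioi 0)) :
    HasSum H (a * ∫ r in Set.Ioi (0 : ℝ), H ⌊r * a⌋₊) := by
  have hm : Measurable fun r : ℝ => ⌊r * a⌋₊ := Nat.measurable_floor.comp (measurable_id.mul_const a)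
  have hmap : (volume.restrict (Set.Ioi (0 : ℝ))).map (fun r : ℝ => ⌊r * a⌋₊) =
      ENNReal.ofReal (1 / a) • Measure.count := by
    refine Measure.ext_of_singleton fun k => ?_
    -- Adding the null point `0` makes every fibre, including that over `k = 0`, a half-open
    -- interval.
    rw [Measure.restrict_congr_set Ioi_ae_eq_Ici, Measure.map_apply hm (measurableSet_singleton k),
      Measure.restrict_apply (hm (measurableSet_singleton k)), Measure.smul_apply,
      Measure.count_singleton, smul_eq_mul, mul_one]
    have hset : (fun r : ℝ => ⌊r * a⌋₊) ⁻¹' {k} ∩ Set.Ici 0 = Set.Ico (k / a) ((k + 1) / a) := by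
      ext r
      simp only [Set.mem_inter_iff, Set.mem_preimage, Set.mem_singleton_iff, Set.mem_Ici,
        Set.mem_Ico, div_le_iff₀ ha, lt_div_iff₀ ha]
      constructor
      · rintro ⟨h, h0⟩
        exact (Nat.floor_eq_iff (mul_nonneg h0 ha.le)).1 h
      · rintro ⟨h1, h2⟩
        have h0 : 0 ≤ r * a := (Nat.cast_nonneg k).trans h1
        exact ⟨(Nat.floor_eq_iff h0).2 ⟨h1, h2⟩, nonneg_of_mul_nonneg_left h0 ha⟩
    rw [hset, Real.volume_Ico]
    congr 1
    ring
  have hc : ENNReal.ofReal (1 / a) ≠ 0 := (ENNReal.ofReal_pos.2 (by positivity)).ne'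
  have hint : Integrable H (Measure.count : Measure ℕ) := by
    rw [← integrable_smul_measure hc ENNReal.ofReal_ne_top, ← hmap]
    exact (integrable_map_measure Measurable.of_discrete.aestronglyMeasurable hm.aemeasurable).2 hH
  have h1 : ∫ r in Set.Ioi (0 : ℝ), H ⌊r * a⌋₊ = 1 / a * ∑' k, H k := by
    rw [← integral_map (f := H) hm.aemeasurable Measurable.of_discrete.aestronglyMeasurable, hmap,
      integral_smul_measure, integral_countable hint, ENNReal.toReal_ofReal (by positivity)]
    simp [Measure.real]
  have hs : Summable H := (hasFiniteIntegral_count_iff.1 hint.2).of_norm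
  rw [h1, ← mul_assoc, mul_one_div_cancel ha.ne', one_mul]
  exact hs.hasSum

/-- A positive nondecreasing sequence that varies regularly with index `β ≥ 0`. -/
structure RegularGrowth (q : ℕ → ℝ) (β : ℝ) : Prop where
  pos : ∀ k, 0 < q k
  mono : Monotone q
  index_nonneg : 0 ≤ β
  ratio : ∀ r : ℝ, 0 < r → Tendsto (fun a : ℝ => q ⌊r * a⌋₊ / q ⌊a⌋₊) atTop (𝓝 (r ^ β))

namespace RegularGrowth

variable {q : ℕ → ℝ} {β : ℝ} (hq : RegularGrowth q β)
include hq

/-- For `p > β` and large `a`, doubling the argument multiplies `q` by at most `2 ^ p`. Iterating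
along powers of two gives the bound for `r ≥ 1`; for `r < 1` monotonicity is enough. -/
lemma exists_pow_bound : ∃ p : ℕ, ∀ᶠ a : ℝ in atTop, ∀ r : ℝ, 0 ≤ r →
    q ⌊r * a⌋₊ ≤ (2 * (1 + r)) ^ p * q ⌊a⌋₊ := by
  obtain ⟨p, hp⟩ := exists_nat_gt β
  have hlt : (2 : ℝ) ^ β < 2 ^ p := by
    rw [← Real.rpow_natCast]
    exact Real.rpow_lt_rpow_of_exponent_lt one_lt_two hp
  obtain ⟨a₀, ha₀⟩ := eventually_atTop.1 ((hq.ratio 2 two_pos).eventually (gt_mem_nhds hlt))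
  refine ⟨p, eventually_atTop.2 ⟨max a₀ 0, fun a ha r hr => ?_⟩⟩
  have haa₀ : a₀ ≤ a := (le_max_left _ _).trans ha
  have ha0 : 0 ≤ a := (le_max_right _ _).trans ha
  have hdouble : ∀ k : ℕ, q ⌊2 ^ k * a⌋₊ ≤ (2 ^ p) ^ k * q ⌊a⌋₊ := by
    intro k
    induction k with
    | zero => simp
    | succ k ih =>
      have h2 : a ≤ 2 ^ k * a := le_mul_of_one_le_left ha0 (one_le_pow₀ one_le_two)
      have h3 := ha₀ (2 ^ k * a) (haa₀.trans h2)
      rw [div_lt_iff₀ (hq.pos _), ← mul_assoc, ← pow_succ'] at h3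
      calc q ⌊2 ^ (k + 1) * a⌋₊ ≤ 2 ^ p * q ⌊2 ^ k * a⌋₊ := h3.le
        _ ≤ 2 ^ p * ((2 ^ p) ^ k * q ⌊a⌋₊) := by gcongr
        _ = (2 ^ p) ^ (k + 1) * q ⌊a⌋₊ := by ring
  rcases lt_or_ge r 1 with hr1 | hr1
  · have h1 : q ⌊r * a⌋₊ ≤ q ⌊a⌋₊ :=
      hq.mono (Nat.floor_mono (mul_le_of_le_one_left ha0 hr1.le))
    exact h1.trans (le_mul_of_one_le_left (hq.pos _).le (one_le_pow₀ (by linarith)))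
  · obtain ⟨k, hk1, hk2⟩ := exists_nat_pow_near hr1 one_lt_two
    calc q ⌊r * a⌋₊ ≤ q ⌊2 ^ (k + 1) * a⌋₊ := hq.mono (Nat.floor_mono (by gcongr))
      _ ≤ (2 ^ p) ^ (k + 1) * q ⌊a⌋₊ := hdouble _
      _ = (2 ^ (k + 1)) ^ p * q ⌊a⌋₊ := by rw [← pow_mul, ← pow_mul, mul_comm p]
      _ ≤ (2 * (1 + r)) ^ p * q ⌊a⌋₊ := by
          have := (hq.pos ⌊a⌋₊).le
          have h2 : (2 : ℝ) ^ (k + 1) ≤ 2 * (1 + r) := by rw [pow_succ]; linarith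
          gcongr

lemma exists_exp_bound {δ : ℝ} (hδ : 0 < δ) : ∃ C : ℝ, 0 < C ∧ ∀ᶠ a : ℝ in atTop, ∀ r : ℝ, 0 ≤ r →
    q ⌊r * a⌋₊ ≤ C * Real.exp (δ * r) * q ⌊a⌋₊ := by
  obtain ⟨p, hp⟩ := hq.exists_pow_bound
  refine ⟨(2 / δ) ^ p * (p.factorial : ℝ) * Real.exp δ, by positivity, ?_⟩
  filter_upwards [hp] with a ha r hr
  refine (ha r hr).trans (mul_le_mul_of_nonneg_right ?_ (hq.pos _).le)
  have h := Real.pow_div_factorial_le_exp (x := δ * (1 + r)) (by positivity) p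
  rw [div_le_iff₀ (by positivity)] at h
  calc (2 * (1 + r)) ^ p = (2 / δ) ^ p * (δ * (1 + r)) ^ p := by
        rw [← mul_pow]; congr 1; field_simp
    _ ≤ (2 / δ) ^ p * (Real.exp (δ * (1 + r)) * p.factorial) := by gcongr
    _ = (2 / δ) ^ p * p.factorial * Real.exp δ * Real.exp (δ * r) := by
        rw [mul_add, mul_one, Real.exp_add]; ring

lemma tilted_bound {θ : ℝ} (hθ : 0 < θ) : ∃ C : ℝ, 0 < C ∧ ∀ᶠ a : ℝ in atTop, ∀ k : ℕ,
    q k * Real.exp (-(θ / a * k)) ≤ C * q ⌊a⌋₊ := by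
  obtain ⟨C, hC, h⟩ := hq.exists_exp_bound hθ
  refine ⟨C, hC, ?_⟩
  filter_upwards [h, eventually_gt_atTop 0] with a ha ha0 k
  have := ha (k / a) (by positivity)
  rw [div_mul_cancel₀ _ ha0.ne', Nat.floor_natCast] at this
  rw [Real.exp_neg, ← div_eq_mul_inv, div_le_iff₀ (Real.exp_pos _)]
  refine this.trans_eq ?_
  rw [show θ / a * k = θ * (k / a) by ring]
  ring

/-- Half of the rate `θ` absorbs the growth of `q`; the rounding costs at most `e^θ` once `a ≥ 1`.
The result is an integrable majorant independent of `a`. -/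
lemma floor_integrand_bound {θ : ℝ} (hθ : 0 < θ) : ∃ C : ℝ, ∀ᶠ a : ℝ in atTop, ∀ r : ℝ, 0 < r →
    q ⌊r * a⌋₊ / q ⌊a⌋₊ * Real.exp (-(θ / a * ⌊r * a⌋₊)) ≤ C * Real.exp (-(θ / 2) * r) := by
  obtain ⟨C, hC, h⟩ := hq.exists_exp_bound (half_pos hθ)
  refine ⟨C * Real.exp θ, ?_⟩
  filter_upwards [h, eventually_ge_atTop 1] with a ha ha1 r hr
  have ha0 : 0 < a := one_pos.trans_le ha1
  have h1 : q ⌊r * a⌋₊ / q ⌊a⌋₊ ≤ C * Real.exp (θ / 2 * r) :=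
    (div_le_iff₀ (hq.pos _)).2 (ha r hr.le)
  have h2 : -(θ / a * ⌊r * a⌋₊) ≤ θ - θ * r := by
    have h3 := (Nat.lt_floor_add_one (r * a)).le
    have h4 : θ / a * (r * a) ≤ θ / a * (⌊r * a⌋₊ + 1) := by gcongr
    have h5 : θ / a * (r * a) = θ * r := by field_simp
    have h6 : θ / a ≤ θ := div_le_self hθ.le ha1
    linarith
  calc q ⌊r * a⌋₊ / q ⌊a⌋₊ * Real.exp (-(θ / a * ⌊r * a⌋₊))
      ≤ C * Real.exp (θ / 2 * r) * Real.exp (θ - θ * r) := by gcongr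
    _ = C * Real.exp θ * Real.exp (-(θ / 2) * r) := by
        rw [mul_assoc, ← Real.exp_add, mul_assoc, ← Real.exp_add]
        congr 2
        ring

/-- Riemann sums of the exponentially tilted sequence converge after rescaling. -/
theorem tendsto_tilted_sum {θ : ℝ} (hθ : 0 < θ) {φ : ℝ → ℝ}
    (hφb : ∀ r, |φ r| ≤ 1) (hφc : ∀ᵐ r, ContinuousAt φ r) :
    (∀ᶠ a : ℝ in atTop, Summable fun k : ℕ => q k * Real.exp (-(θ / a * k)) * φ (1 / a * k)) ∧
    Tendsto (fun a : ℝ => (∑' k : ℕ, q k * Real.exp (-(θ / a * k)) * φ (1 / a * k)) /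
      (a * q ⌊a⌋₊)) atTop (𝓝 (∫ r in Set.Ioi (0 : ℝ), r ^ β * Real.exp (-(θ * r)) * φ r)) := by
  obtain ⟨C, hC⟩ := hq.floor_integrand_bound hθ
  let F : ℝ → ℝ → ℝ := fun a r => q ⌊r * a⌋₊ / q ⌊a⌋₊ * Real.exp (-(θ / a * ⌊r * a⌋₊)) *
    φ (1 / a * ⌊r * a⌋₊)
  have hfl : ∀ a : ℝ, Measurable fun r : ℝ => ⌊r * a⌋₊ := fun a =>
    Nat.measurable_floor.comp (measurable_id.mul_const a)
  have hFm : ∀ a, Measurable (F a) := fun a =>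
    (Measurable.of_discrete (f := fun k : ℕ => q k / q ⌊a⌋₊ * Real.exp (-(θ / a * k)) *
      φ (1 / a * k))).comp (hfl a)
  have hbound : ∀ᶠ a : ℝ in atTop, ∀ᵐ r ∂(volume.restrict (Set.Ioi (0 : ℝ))),
      ‖F a r‖ ≤ C * Real.exp (-(θ / 2) * r) := by
    filter_upwards [hC] with a ha
    refine (ae_restrict_iff' measurableSet_Ioi).2 (ae_of_all _ fun r hr => ?_)
    have h0 : 0 ≤ q ⌊r * a⌋₊ / q ⌊a⌋₊ * Real.exp (-(θ / a * ⌊r * a⌋₊)) :=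
      mul_nonneg (div_nonneg (hq.pos _).le (hq.pos _).le) (Real.exp_pos _).le
    rw [Real.norm_eq_abs, abs_mul, abs_of_nonneg h0]
    exact (mul_le_of_le_one_right h0 (hφb _)).trans (ha r hr)
  have hint : IntegrableOn (fun r => C * Real.exp (-(θ / 2) * r)) (Set.Ioi 0) :=
    (exp_neg_integrableOn_Ioi 0 (half_pos hθ)).const_mul C
  have hsum : ∀ᶠ a : ℝ in atTop,
      HasSum (fun k : ℕ => q k / q ⌊a⌋₊ * Real.exp (-(θ / a * k)) * φ (1 / a * k))
        (a * ∫ r in Set.Ioi (0 : ℝ), F a r) := by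
    filter_upwards [hbound, eventually_gt_atTop 0] with a ha ha0
    exact hasSum_of_integrableOn_floor ha0 (hint.mono' (hFm a).aestronglyMeasurable ha)
  have hlim : Tendsto (fun a => ∫ r in Set.Ioi (0 : ℝ), F a r) atTop
      (𝓝 (∫ r in Set.Ioi (0 : ℝ), r ^ β * Real.exp (-(θ * r)) * φ r)) := by
    refine tendsto_integral_filter_of_dominated_convergence _
      (Eventually.of_forall fun a => (hFm a).aestronglyMeasurable) hbound hint ?_
    refine (ae_restrict_iff' measurableSet_Ioi).2 ?_
    filter_upwards [hφc] with r hrc hr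
    have h1 : Tendsto (fun a : ℝ => (⌊r * a⌋₊ : ℝ) / a) atTop (𝓝 r) :=
      tendsto_nat_floor_mul_div_atTop (le_of_lt hr)
    have h2 : Tendsto (fun a : ℝ => Real.exp (-(θ / a * ⌊r * a⌋₊))) atTop
        (𝓝 (Real.exp (-(θ * r)))) := by
      refine (Real.continuous_exp.tendsto _).comp ((h1.const_mul θ).neg.congr fun a => ?_)
      ring
    have h3 : Tendsto (fun a : ℝ => φ (1 / a * ⌊r * a⌋₊)) atTop (𝓝 (φ r)) :=
      hrc.tendsto.comp (h1.congr fun a => by ring)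
    exact ((hq.ratio r hr).mul h2).mul h3
  have hscale : ∀ a : ℝ, (fun k : ℕ => q k * Real.exp (-(θ / a * k)) * φ (1 / a * k)) =
      fun k : ℕ => q ⌊a⌋₊ * (q k / q ⌊a⌋₊ * Real.exp (-(θ / a * k)) * φ (1 / a * k)) := fun a => by
    funext k
    have := (hq.pos ⌊a⌋₊).ne'
    field_simp
  constructor
  · filter_upwards [hsum] with a ha
    rw [hscale]
    exact ha.summable.mul_left _
  · refine hlim.congr' ?_
    filter_upwards [hsum, eventually_gt_atTop 0] with a ha ha0
    rw [hscale, tsum_mul_left, ha.tsum_eq]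
    have := (hq.pos ⌊a⌋₊).ne'
    field_simp

end RegularGrowth

/-! ### Partition functions and the Gamma limit -/

/-- The partition function `∑ k, q(k) e^{-sk}`. -/
noncomputable def partitionFn (q : ℕ → ℝ) (s : ℝ) : ℝ := ∑' k : ℕ, q k * Real.exp (-(s * k))

namespace RegularGrowth

variable {q : ℕ → ℝ} {β : ℝ} (hq : RegularGrowth q β)
include hq

lemma eventually_summable_tilted {θ : ℝ} (hθ : 0 < θ) :
    ∀ᶠ a : ℝ in atTop, Summable fun k : ℕ => q k * Real.exp (-(θ / a * k)) := by
  simpa using (hq.tendsto_tilted_sum hθ (φ := fun _ => 1) (by simp)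
    (ae_of_all _ fun _ => continuousAt_const)).1

lemma tendsto_partitionFn {θ : ℝ} (hθ : 0 < θ) :
    Tendsto (fun a : ℝ => partitionFn q (θ / a) / (a * q ⌊a⌋₊)) atTop
      (𝓝 ((1 / θ) ^ (β + 1) * Real.Gamma (β + 1))) := by
  have hβ := hq.index_nonneg
  have h := (hq.tendsto_tilted_sum hθ (φ := fun _ => 1) (by simp)
    (ae_of_all _ fun _ => continuousAt_const)).2
  have h2 := Real.integral_rpow_mul_exp_neg_mul_Ioi (a := β + 1) (by linarith) hθ
  simp only [mul_one] at h
  rw [add_sub_cancel_right] at h2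
  rw [h2] at h
  exact h

/-- The common scale `a * q ⌊a⌋₊` and the Gamma factor cancel, leaving an explicit limit. -/
lemma tendsto_partitionFn_ratio {θ θ' : ℝ} (hθ : 0 < θ) (hθ' : 0 < θ') :
    Tendsto (fun a : ℝ => partitionFn q (θ / a) / partitionFn q (θ' / a)) atTop
      (𝓝 ((θ' / θ) ^ (β + 1))) := by
  have hβ := hq.index_nonneg
  have hG : Real.Gamma (β + 1) ≠ 0 := (Real.Gamma_pos_of_pos (by linarith)).ne'
  have hθp : (1 / θ') ^ (β + 1) ≠ 0 := (Real.rpow_pos_of_pos (by positivity) _).ne'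
  have h := (hq.tendsto_partitionFn hθ).div (hq.tendsto_partitionFn hθ') (mul_ne_zero hθp hG)
  rw [mul_div_mul_right _ _ hG, ← Real.div_rpow (by positivity) (by positivity),
    show 1 / θ / (1 / θ') = θ' / θ by field_simp] at h
  refine h.congr' ?_
  filter_upwards [eventually_gt_atTop 0] with a ha
  have := (hq.pos ⌊a⌋₊).ne'
  exact div_div_div_cancel_right₀ (by positivity) _ _

end RegularGrowth

lemma openInterval_subset_Ioi {b : ℝ} (hb : 0 ≤ b) (c : EReal) :
    openInterval b c ⊆ Set.Ioi 0 := fun _ h => hb.trans_lt h.1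

lemma isOpen_openInterval (b : ℝ) (c : EReal) : IsOpen (openInterval b c) :=
  isOpen_Ioi.inter (isOpen_Iio.preimage continuous_coe_real_ereal)

lemma ae_continuousAt_indicator_openInterval (b : ℝ) (c : EReal) :
    ∀ᵐ r : ℝ, ContinuousAt ((openInterval b c).indicator fun _ => (1 : ℝ)) r := by
  -- For `c = ⊤` the default `c.toReal = 0` merely excludes one harmless point.
  have hfin : ({b, c.toReal} : Set ℝ).Finite := by simp
  filter_upwards [hfin.countable.ae_notMem volume] with r hr
  simp only [Set.mem_insert_iff, Set.mem_singleton_iff, not_or] at hr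
  by_cases h : r ∈ openInterval b c
  · refine (continuousAt_const (y := (1 : ℝ))).congr ?_
    filter_upwards [(isOpen_openInterval b c).mem_nhds h] with x hx
    rw [Set.indicator_of_mem hx]
  · refine (continuousAt_const (y := (0 : ℝ))).congr ?_
    have hopen : ∀ᶠ x in 𝓝 r, x ∉ openInterval b c := by
      rcases lt_or_ge b r with hbr | hbr
      · have hcr : c < r := by
          refine lt_of_le_of_ne (not_lt.1 fun hlt => h ⟨hbr, hlt⟩) fun hc => hr.2 ?_
          rw [hc, EReal.toReal_coe]
        filter_upwards [(isOpen_Ioi.preimage continuous_coe_real_ereal).mem_nhds hcr] with x hx hxI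
        exact lt_asymm hxI.2 hx
      · filter_upwards [isOpen_Iio.mem_nhds (lt_of_le_of_ne hbr hr.1)] with x hx hxI
        exact lt_asymm hxI.1 hx
    filter_upwards [hopen] with x hx
    rw [Set.indicator_of_notMem hx]

/-- The quotient form matches the limits of the tilted sum and of the partition function. -/
lemma gammaMeasure_real_openInterval {m θ : ℝ} (hm : 0 < m) (hθ : 0 < θ) {b : ℝ} (hb : 0 ≤ b)
    (c : EReal) :
    (gammaMeasure m θ).real (openInterval b c) =
      (∫ r in Set.Ioi (0 : ℝ), r ^ (m - 1) * Real.exp (-(θ * r)) *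
        (openInterval b c).indicator (fun _ => (1 : ℝ)) r) / ((1 / θ) ^ m * Real.Gamma m) := by
  have hI := (isOpen_openInterval b c).measurableSet
  have hsub := openInterval_subset_Ioi hb c
  rw [gammaMeasure, measureReal_def, withDensity_apply _ hI]
  have h1 : (∫⁻ r in openInterval b c, gammaPDF m θ r).toReal =
      ∫ r in openInterval b c, gammaPDFReal m θ r :=
    (integral_eq_lintegral_of_nonneg_ae (ae_of_all _ fun r => gammaPDFReal_nonneg hm hθ r)
      (measurable_gammaPDFReal m θ).aestronglyMeasurable).symm
  have h2 : ∫ r in Set.Ioi (0 : ℝ), r ^ (m - 1) * Real.exp (-(θ * r)) *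
        (openInterval b c).indicator (fun _ => (1 : ℝ)) r =
      ∫ r in openInterval b c, r ^ (m - 1) * Real.exp (-(θ * r)) := by
    have : ∀ r : ℝ, r ^ (m - 1) * Real.exp (-(θ * r)) *
        (openInterval b c).indicator (fun _ => (1 : ℝ)) r =
        (openInterval b c).indicator (fun r => r ^ (m - 1) * Real.exp (-(θ * r))) r := fun r => by
      by_cases hr : r ∈ openInterval b c <;> simp [hr]
    simp_rw [this]
    rw [setIntegral_indicator hI, Set.inter_eq_self_of_subset_right hsub]
  rw [h1, h2, ← integral_div]
  refine setIntegral_congr_fun hI fun r hr => ?_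
  simp only [gammaPDFReal, if_pos (Set.mem_Ioi.1 (hsub hr)).le]
  have := (Real.Gamma_pos_of_pos hm).ne'
  have := (Real.rpow_pos_of_pos hθ m).ne'
  rw [Real.div_rpow zero_le_one hθ.le, Real.one_rpow]
  field_simp

/-! ### Lower bound for the weight of a fixed total -/

/-- Bounding a partition function by its two tails and the coefficient at `L`. -/
lemma partitionFn_pow_le {q : ℕ → ℝ} (hq0 : ∀ k, 0 ≤ q k) (hmono : Monotone q) {s₀ s₁ s₂ κ : ℝ}
    (h01 : s₀ ≤ s₁) (h12 : s₁ ≤ s₂) (hs₁ : 0 ≤ s₁)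
    (hs : ∀ s, s = s₀ ∨ s = s₁ ∨ s = s₂ → Summable fun k : ℕ => q k * Real.exp (-(s * k)))
    (N L : ℕ) :
    partitionFn q s₁ ^ (N + 1) ≤
      Real.exp (-((s₁ - s₀) * L)) * partitionFn q s₀ ^ (N + 1) +
      Real.exp ((s₂ - s₁) * (κ * L)) * partitionFn q s₂ ^ (N + 1) +
      (L + 1) * (convPow q (N + 1) L * Real.exp (-(s₁ * (κ * L)))) := by
  have hZ := convPow_nonneg hq0 (N + 1)
  have hsum : ∀ s, s = s₀ ∨ s = s₁ ∨ s = s₂ →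
      HasSum (fun l : ℕ => convPow q (N + 1) l * Real.exp (-(s * l))) (partitionFn q s ^ (N + 1)) :=
    fun s h => by
      have := hasSum_convPow (fun k => mul_nonneg (hq0 k) (Real.exp_pos _).le) (hs s h) (N + 1)
      rwa [funext (convPow_mul_exp q s (N + 1))] at this
  set M := convPow q (N + 1) L * Real.exp (-(s₁ * (κ * L))) with hM
  have hM0 : 0 ≤ M := mul_nonneg (hZ L) (Real.exp_pos _).le
  have hfin : HasSum (fun l : ℕ => if l ∈ Finset.range (L + 1) then M else 0) ((L + 1) * M) := by
    have : HasSum (fun l : ℕ => if l ∈ Finset.range (L + 1) then M else 0)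
        (∑ l ∈ Finset.range (L + 1), if l ∈ Finset.range (L + 1) then M else 0) :=
      hasSum_sum_of_ne_finset_zero fun l hl => if_neg hl
    rw [Finset.sum_ite_mem, Finset.inter_self, Finset.sum_const, Finset.card_range,
      nsmul_eq_mul] at this
    exact_mod_cast this
  refine hasSum_le (fun l => ?_) (hsum s₁ (by simp)) ((((hsum s₀ (by simp)).mul_left _).add
    ((hsum s₂ (by simp)).mul_left _)).add hfin)
  have hA : 0 ≤ Real.exp (-((s₁ - s₀) * L)) * (convPow q (N + 1) l * Real.exp (-(s₀ * l))) :=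
    mul_nonneg (Real.exp_pos _).le (mul_nonneg (hZ l) (Real.exp_pos _).le)
  have hB : 0 ≤ Real.exp ((s₂ - s₁) * (κ * L)) * (convPow q (N + 1) l * Real.exp (-(s₂ * l))) :=
    mul_nonneg (Real.exp_pos _).le (mul_nonneg (hZ l) (Real.exp_pos _).le)
  have hC : 0 ≤ if l ∈ Finset.range (L + 1) then M else 0 := by split_ifs <;> simp [hM0]
  -- Below `κ * L` the tilt is raised to `s₂`, above `L` it is lowered to `s₀`; in between,
  -- monotonicity replaces the coefficient at `l` by the one at `L`.
  by_cases hl : l < L + 1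
  · by_cases hκ : (l : ℝ) < κ * L
    · refine le_trans ?_ ((le_add_of_nonneg_left hA).trans (le_add_of_nonneg_right hC))
      rw [mul_left_comm, ← Real.exp_add]
      refine mul_le_mul_of_nonneg_left (Real.exp_le_exp.2 ?_) (hZ l)
      nlinarith
    · refine le_trans ?_ (le_add_of_nonneg_left (add_nonneg hA hB))
      rw [if_pos (Finset.mem_range.2 hl), hM]
      refine mul_le_mul (convPow_succ_le_of_monotone hq0 hmono N (Nat.le_of_lt_succ hl))
        (Real.exp_le_exp.2 ?_) (Real.exp_pos _).le (hZ L)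
      have := mul_le_mul_of_nonneg_left (not_lt.1 hκ) hs₁
      linarith
  · refine le_trans ?_ ((le_add_of_nonneg_right hB).trans (le_add_of_nonneg_right hC))
    rw [mul_left_comm, ← Real.exp_add]
    refine mul_le_mul_of_nonneg_left (Real.exp_le_exp.2 ?_) (hZ l)
    have : (L : ℝ) ≤ l := by exact_mod_cast (by omega : L ≤ l)
    nlinarith

/-- If the base converges to a limit below one, the powers eventually drop below any bound. -/
lemma eventually_pow_lt {u : ℕ → ℝ} {l ε : ℝ} (hu : Tendsto u atTop (𝓝 l)) (hl : l < 1)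
    (hu0 : ∀ᶠ N in atTop, 0 ≤ u N) (hε : 0 < ε) : ∀ᶠ N in atTop, u N ^ N < ε := by
  obtain ⟨r, hr1, hr2⟩ := exists_between (max_lt hl one_pos)
  have hr0 : 0 ≤ r := (le_max_right l 0).trans hr1.le
  filter_upwards [hu.eventually (gt_mem_nhds ((le_max_left l 0).trans_lt hr1)), hu0,
    (tendsto_pow_atTop_nhds_zero_of_lt_one hr0 hr2).eventually (gt_mem_nhds hε)] with N h1 h2 h3
  exact (pow_le_pow_left₀ h2 h1.le N).trans_lt h3

namespace RegularGrowth

variable {q : ℕ → ℝ} {β : ℝ} (hq : RegularGrowth q β)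
include hq

lemma eventually_partitionFn_pos {θ : ℝ} (hθ : 0 < θ) :
    ∀ᶠ a : ℝ in atTop, 0 < partitionFn q (θ / a) := by
  filter_upwards [hq.eventually_summable_tilted hθ] with a ha
  exact ha.tsum_pos (fun k => (mul_pos (hq.pos k) (Real.exp_pos _)).le) 0
    (mul_pos (hq.pos 0) (Real.exp_pos _))

variable {a : ℕ → ℝ} {L : ℕ → ℕ} {T : ℝ} (ha : Tendsto a atTop atTop)
  (hLT : Tendsto (fun N : ℕ => (L N : ℝ) / ((N : ℝ) * a N)) atTop (𝓝 T))
include ha hLT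

/-- A tilted power of the ratio of two partition functions, with its limiting base. -/
lemma tendsto_tilted_ratio {θ θ' : ℝ} (hθ : 0 < θ) (hθ' : 0 < θ') (c : ℝ) :
    Tendsto (fun N : ℕ => Real.exp (c * (L N / (N * a N))) *
      (partitionFn q (θ / a N) / partitionFn q (θ' / a N))) atTop
      (𝓝 (Real.exp (c * T) * (θ' / θ) ^ (β + 1))) :=
  ((Real.continuous_exp.tendsto _).comp (hLT.const_mul c)).mul
    ((hq.tendsto_partitionFn_ratio hθ hθ').comp ha)

/-- The total weight is at least the tilted product weight up to a subexponential factor. -/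
theorem eventually_convPow_ge (hT : 0 < T) {ε : ℝ} (hε : 0 < ε) :
    ∀ᶠ N : ℕ in atTop,
      partitionFn q ((β + 1) / T / a N) ^ N * Real.exp (-(ε * N)) ≤
        (L N + 1) * (convPow q N (L N) * Real.exp (-((β + 1) / T / a N * L N))) := by
  have hβ := hq.index_nonneg
  set m := β + 1 with hm
  have hm0 : 0 < m := by linarith
  set θ₀ := m / T with hθ₀
  have hθ₀0 : 0 < θ₀ := div_pos hm0 hT
  have hθT : θ₀ * T = m := div_mul_cancel₀ m hT.ne'
  -- Under the tilts `θ₀`, `θ₁ = θ₀ e^y`, `θ₂ = θ₀ e^{2y}` the mean totals are asymptotically `L`,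
  -- `e^{-y} L`, `κ L`. So under `θ₁` the total falls strictly inside the window from `κ L` to `L`.
  -- The choice of `y` makes `2my = ε/2`, the exponential cost per agent allowed in `hl3`.
  set y := ε / (4 * m) with hy
  have hy0 : 0 < y := by positivity
  set θ₁ := θ₀ * Real.exp y with hθ₁
  set θ₂ := θ₀ * Real.exp (2 * y) with hθ₂
  set κ := Real.exp (-(2 * y)) with hκ
  have hθ₁0 : 0 < θ₁ := by positivity
  have hθ₂0 : 0 < θ₂ := by positivity
  have h01 : θ₀ ≤ θ₁ := le_mul_of_one_le_right hθ₀0.le (Real.one_le_exp hy0.le)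
  have h12 : θ₁ ≤ θ₂ :=
    mul_le_mul_of_nonneg_left (Real.exp_le_exp.2 (by linarith)) hθ₀0.le
  have hθ₂κ : θ₂ * κ = θ₀ := by
    rw [hθ₂, hκ, mul_assoc, ← Real.exp_add, add_neg_cancel, Real.exp_zero, mul_one]
  have hθ₁κ : θ₁ * κ = θ₀ * Real.exp (-y) := by
    rw [hθ₁, hκ, mul_assoc, ← Real.exp_add]
    congr 2
    ring
  have hrpow : ∀ z : ℝ, Real.exp z ^ m = Real.exp (z * m) := fun z => (Real.exp_mul z m).symm
  have hlow := hq.tendsto_tilted_ratio ha hLT hθ₀0 hθ₁0 (-(θ₁ - θ₀))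
  have hup := hq.tendsto_tilted_ratio ha hLT hθ₂0 hθ₁0 ((θ₂ - θ₁) * κ)
  have hmid := hq.tendsto_tilted_ratio ha hLT hθ₁0 hθ₀0 (θ₁ * κ - θ₀)
  -- Since `θ₀ * T = m`, the exponent is `m * (1 - e^y + y)`, negative because `e^y > 1 + y`. The
  -- next two bounds use the same inequality at `-y`.
  have hl1 : Real.exp (-(θ₁ - θ₀) * T) * (θ₁ / θ₀) ^ m < 1 := by
    rw [show θ₁ / θ₀ = Real.exp y by rw [hθ₁]; field_simp, hrpow, ← Real.exp_add, Real.exp_lt_one_iff]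
    have h1 : -(θ₁ - θ₀) * T + y * m = (θ₀ * T) * (1 - Real.exp y) + y * m := by rw [hθ₁]; ring
    rw [h1, hθT]
    nlinarith [Real.add_one_lt_exp hy0.ne']
  have hl2 : Real.exp ((θ₂ - θ₁) * κ * T) * (θ₁ / θ₂) ^ m < 1 := by
    have h0 : θ₁ / θ₂ = Real.exp (-y) := by
      rw [hθ₁, hθ₂, mul_div_mul_left _ _ hθ₀0.ne', ← Real.exp_sub]
      congr 1
      ring
    rw [h0, hrpow, ← Real.exp_add, Real.exp_lt_one_iff]
    have h1 : (θ₂ - θ₁) * κ * T = (θ₀ * T) * (1 - Real.exp (-y)) := by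
      rw [sub_mul, hθ₂κ, hθ₁κ]; ring
    rw [h1, hθT]
    nlinarith [Real.add_one_lt_exp (neg_ne_zero.2 hy0.ne')]
  have hl3 : Real.exp (-(ε / 2)) < Real.exp ((θ₁ * κ - θ₀) * T) * (θ₀ / θ₁) ^ m := by
    have h0 : θ₀ / θ₁ = Real.exp (-y) := by
      rw [hθ₁, Real.exp_neg]
      field_simp
    rw [h0, hrpow, ← Real.exp_add, Real.exp_lt_exp]
    have h1 : (θ₁ * κ - θ₀) * T = (θ₀ * T) * (Real.exp (-y) - 1) := by rw [hθ₁κ]; ring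
    rw [h1, hθT]
    have h2 : m * y = ε / 4 := by rw [hy]; field_simp
    nlinarith [Real.add_one_lt_exp (neg_ne_zero.2 hy0.ne')]
  have hpos : ∀ {θ : ℝ}, 0 < θ → ∀ᶠ N in atTop, 0 < partitionFn q (θ / a N) := fun hθ =>
    ha.eventually (hq.eventually_partitionFn_pos hθ)
  have hsm : ∀ {θ : ℝ}, 0 < θ → ∀ᶠ N in atTop,
      Summable fun k : ℕ => q k * Real.exp (-(θ / a N * k)) := fun hθ =>
    ha.eventually (hq.eventually_summable_tilted hθ)
  have hhalf : ∀ᶠ N : ℕ in atTop, Real.exp (-(ε / 2)) ^ N < 1 / 2 :=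
    (tendsto_pow_atTop_nhds_zero_of_lt_one (Real.exp_pos _).le
      (Real.exp_lt_one_iff.2 (by linarith))).eventually (gt_mem_nhds (by norm_num))
  filter_upwards [eventually_pow_lt hlow hl1 (by
      filter_upwards [hpos hθ₀0, hpos hθ₁0] with N h0 h1; positivity) (by norm_num : (0 : ℝ) < 1 / 4),
    eventually_pow_lt hup hl2 (by
      filter_upwards [hpos hθ₂0, hpos hθ₁0] with N h2 h1; positivity) (by norm_num : (0 : ℝ) < 1 / 4),
    hmid.eventually (lt_mem_nhds hl3), hpos hθ₀0, hpos hθ₁0, hpos hθ₂0, hsm hθ₀0, hsm hθ₁0, hsm hθ₂0,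
    hhalf, ha.eventually_gt_atTop 0, eventually_ge_atTop 1]
    with N hN1 hN2 hN3 hW0 hW1 hW2 hS0 hS1 hS2 hNh haN hN
  have hN0 : (0 : ℝ) < N := by exact_mod_cast hN
  have hexp : ∀ c : ℝ, Real.exp (c * (L N / (N * a N))) ^ N = Real.exp (c / a N * L N) := fun c => by
    rw [← Real.exp_nat_mul]
    congr 1
    field_simp
  rw [mul_pow, div_pow, hexp, mul_div_assoc', div_lt_iff₀ (pow_pos hW1 N)] at hN1 hN2
  have hN3' := pow_le_pow_left₀ (Real.exp_pos _).le hN3.le N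
  rw [mul_pow, div_pow, hexp, mul_div_assoc', le_div_iff₀ (pow_pos hW0 N)] at hN3'
  have hmain := partitionFn_pow_le (q := q) (κ := κ) (s₀ := θ₀ / a N) (s₁ := θ₁ / a N)
    (s₂ := θ₂ / a N) (fun k => (hq.pos k).le) hq.mono (by gcongr) (by gcongr) (by positivity)
    (by rintro s (rfl | rfl | rfl) <;> assumption) (N - 1) (L N)
  rw [Nat.sub_add_cancel hN] at hmain
  have e1 : -((θ₁ / a N - θ₀ / a N) * L N) = -(θ₁ - θ₀) / a N * L N := by ring
  have e2 : (θ₂ / a N - θ₁ / a N) * (κ * L N) = (θ₂ - θ₁) * κ / a N * L N := by ring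
  rw [e1, e2] at hmain
  set Z := convPow q N (L N) with hZ
  -- Each tail carries at most a quarter of the mass, so the window carries at least half.
  have hmid2 : 1 / 2 * partitionFn q (θ₁ / a N) ^ N ≤
      (L N + 1) * (Z * Real.exp (-(θ₁ / a N * (κ * L N)))) := by linarith
  have e3 : Real.exp (-(θ₁ / a N * (κ * L N))) * Real.exp ((θ₁ * κ - θ₀) / a N * L N) =
      Real.exp (-(θ₀ / a N * L N)) := by
    rw [← Real.exp_add]
    congr 1
    ring
  have e4 : Real.exp (-(ε * N)) = Real.exp (-(ε / 2)) ^ N * Real.exp (-(ε / 2)) ^ N := by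
    rw [← Real.exp_nat_mul, ← Real.exp_add]
    congr 1
    ring
  calc partitionFn q (θ₀ / a N) ^ N * Real.exp (-(ε * N))
      = Real.exp (-(ε / 2)) ^ N * (Real.exp (-(ε / 2)) ^ N * partitionFn q (θ₀ / a N) ^ N) := by
        rw [e4]; ring
    _ ≤ 1 / 2 * (Real.exp ((θ₁ * κ - θ₀) / a N * L N) * partitionFn q (θ₁ / a N) ^ N) := by
        gcongr
    _ = (1 / 2 * partitionFn q (θ₁ / a N) ^ N) * Real.exp ((θ₁ * κ - θ₀) / a N * L N) := by ring
    _ ≤ (L N + 1) * (Z * Real.exp (-(θ₁ / a N * (κ * L N)))) *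
          Real.exp ((θ₁ * κ - θ₀) / a N * L N) := by gcongr
    _ = (L N + 1) * (Z * Real.exp (-(θ₀ / a N * L N))) := by rw [← e3]; ring

end RegularGrowth

/-! ### Concentration under conditioning and the equilibrium limit -/

/-- Jensen's inequality for the exponential function and a finite weighted sum. -/
lemma exp_weighted_mean_mul_le {ι : Type} [Fintype ι] {ω y : ι → ℝ} (hω : ∀ i, 0 ≤ ω i)
    (hpos : 0 < ∑ i, ω i) :
    Real.exp ((∑ i, ω i * y i) / ∑ i, ω i) * ∑ i, ω i ≤ ∑ i, ω i * Real.exp (y i) := by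
  set m := (∑ i, ω i * y i) / ∑ i, ω i with hm
  have h1 : ∑ i, ω i * (y i - m + 1) = ∑ i, ω i := by
    simp only [mul_add, mul_sub, mul_one, Finset.sum_add_distrib, Finset.sum_sub_distrib,
      ← Finset.sum_mul]
    rw [hm, mul_div_cancel₀ _ hpos.ne']
    ring
  rw [← h1, Finset.mul_sum]
  refine Finset.sum_le_sum fun i _ => ?_
  have h2 : Real.exp (y i) = Real.exp m * Real.exp (y i - m) := by
    rw [← Real.exp_add]; congr 1; ring
  rw [h2, mul_left_comm]
  exact mul_le_mul_of_nonneg_left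
    (mul_le_mul_of_nonneg_left (Real.add_one_le_exp _) (Real.exp_pos _).le) (hω i)

/-- Exponential bound for additive functionals under the conditioned product law. -/
lemma exp_mean_mul_convPow_le {w f : ℕ → ℝ} (hw : ∀ k, 0 ≤ w k) (hs : Summable w)
    (hW : 0 < ∑' k, w k) {B : ℝ} (hB : ∀ k, w k ≤ B) (hf0 : ∀ k, 0 ≤ f k) (hf1 : ∀ k, f k ≤ 1)
    {t : ℝ} (ht : |t| ≤ 1) (N L : ℕ) (hZ : 0 < convPow w (N + 1) L) :
    Real.exp (t * ((∑ ξ : Config (Fin (N + 1)) L, (∏ x, w (ξ x)) * ∑ x, f (ξ x)) /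
        convPow w (N + 1) L - (N + 1) * ((∑' k, w k * f k) / ∑' k, w k))) * convPow w (N + 1) L ≤
      B * Real.exp 1 * ((∑' k, w k) * Real.exp (t ^ 2)) ^ N := by
  set p := (∑' k, w k * f k) / ∑' k, w k with hp
  have hwf : Summable fun k => w k * f k := by
    refine Summable.of_nonneg_of_le (fun k => mul_nonneg (hw k) (hf0 k)) (fun k => ?_) hs
    exact mul_le_of_le_one_right (hw k) (hf1 k)
  have hp0 : 0 ≤ p := div_nonneg (tsum_nonneg fun k => mul_nonneg (hw k) (hf0 k)) hW.le
  have hp1 : p ≤ 1 := by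
    rw [hp, div_le_one hW]
    exact hwf.tsum_le_tsum (fun k => mul_le_of_le_one_right (hw k) (hf1 k)) hs
  have hfp : ∀ k, |f k - p| ≤ 1 := fun k => by
    rw [abs_le]; constructor <;> linarith [hf0 k, hf1 k]
  have htfp : ∀ k, |t * (f k - p)| ≤ 1 := fun k => by
    rw [abs_mul]; exact mul_le_one₀ ht (abs_nonneg _) (hfp k)
  set v : ℕ → ℝ := fun k => w k * Real.exp (t * (f k - p)) with hv
  have hv0 : ∀ k, 0 ≤ v k := fun k => mul_nonneg (hw k) (Real.exp_pos _).le
  have hve : ∀ k, v k ≤ w k * Real.exp 1 := fun k =>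
    mul_le_mul_of_nonneg_left (Real.exp_le_exp.2 ((le_abs_self _).trans (htfp k))) (hw k)
  have hvs : Summable v := Summable.of_nonneg_of_le hv0 hve (hs.mul_right _)
  have hvB : ∀ k, v k ≤ B * Real.exp 1 := fun k =>
    (hve k).trans (mul_le_mul_of_nonneg_right (hB k) (Real.exp_pos _).le)
  -- Here `e^x ≤ 1 + x + x²` for `|x| ≤ 1`; the linear term averages to zero because `p` is the
  -- `w`-mean of `f`.
  have hvW : ∑' k, v k ≤ (∑' k, w k) * Real.exp (t ^ 2) := by
    have h1 : ∀ k, v k ≤ (1 + t ^ 2 - t * p) * w k + t * (w k * f k) := fun k => by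
      have h2 := (abs_le.1 (Real.abs_exp_sub_one_sub_id_le (htfp k))).2
      have h3 : (t * (f k - p)) ^ 2 ≤ t ^ 2 := by
        rw [mul_pow]
        exact mul_le_of_le_one_right (sq_nonneg _) ((sq_le_one_iff_abs_le_one _).2 (hfp k))
      have h4 : Real.exp (t * (f k - p)) ≤ 1 + t * (f k - p) + t ^ 2 := by linarith
      calc v k ≤ w k * (1 + t * (f k - p) + t ^ 2) := mul_le_mul_of_nonneg_left h4 (hw k)
        _ = _ := by ring
    have h5 := hvs.tsum_le_tsum h1 ((hs.mul_left _).add (hwf.mul_left _))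
    rw [(hs.mul_left _).tsum_add (hwf.mul_left _), tsum_mul_left, tsum_mul_left] at h5
    have h6 : ∑' k, w k * f k = p * ∑' k, w k := by rw [hp, div_mul_cancel₀ _ hW.ne']
    rw [h6] at h5
    refine h5.trans ?_
    have h7 := mul_le_mul_of_nonneg_left (Real.add_one_le_exp (t ^ 2)) hW.le
    linarith
  have hJ := exp_weighted_mean_mul_le (ω := fun ξ : Config (Fin (N + 1)) L => ∏ x, w (ξ x))
    (y := fun ξ => t * (∑ x, f (ξ x) - (N + 1) * p)) (fun ξ => Finset.prod_nonneg fun x _ => hw _)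
    (by rw [sum_config_prod]; exact hZ)
  rw [sum_config_prod] at hJ
  have hprod : ∀ ξ : Config (Fin (N + 1)) L, (∏ x, w (ξ x)) *
      Real.exp (t * (∑ x, f (ξ x) - (N + 1) * p)) = ∏ x, v (ξ x) := fun ξ => by
    rw [hv, Finset.prod_mul_distrib, ← Real.exp_sum, ← Finset.mul_sum, Finset.sum_sub_distrib,
      Finset.sum_const, Finset.card_univ, Fintype.card_fin, nsmul_eq_mul]
    push_cast
    rfl
  simp_rw [hprod] at hJ
  rw [sum_config_prod] at hJ
  have hmean : (∑ ξ : Config (Fin (N + 1)) L, (∏ x, w (ξ x)) *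
      (t * (∑ x, f (ξ x) - (N + 1) * p))) / convPow w (N + 1) L =
      t * ((∑ ξ : Config (Fin (N + 1)) L, (∏ x, w (ξ x)) * ∑ x, f (ξ x)) /
        convPow w (N + 1) L - (N + 1) * p) := by
    have h1 : ∀ ξ : Config (Fin (N + 1)) L, (∏ x, w (ξ x)) * (t * (∑ x, f (ξ x) - (N + 1) * p)) =
        t * ((∏ x, w (ξ x)) * ∑ x, f (ξ x)) - t * ((N + 1) * p) * ∏ x, w (ξ x) := fun ξ => by ring
    simp_rw [h1]
    rw [Finset.sum_sub_distrib, ← Finset.mul_sum, ← Finset.mul_sum, sum_config_prod]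
    field_simp
  rw [hmean] at hJ
  refine hJ.trans ((convPow_succ_le hv0 hvs hvB N L).trans ?_)
  have hB0 : 0 ≤ B := (hw 0).trans (hB 0)
  exact mul_le_mul_of_nonneg_left (pow_le_pow_left₀ (tsum_nonneg hv0) hvW N) (by positivity)

lemma ncard_eq_sum_indicator {N L : ℕ} (ξ : Config (Fin N) L) (a : ℝ) (I : Set ℝ) :
    (({x : Fin N | 1 / a * (ξ x : ℝ) ∈ I}.ncard : ℕ) : ℝ) =
      ∑ x, I.indicator (fun _ => (1 : ℝ)) (1 / a * (ξ x : ℝ)) := by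
  classical
  rw [Set.ncard_eq_toFinset_card', Set.toFinset_ofPred, Finset.card_filter]
  push_cast
  exact Finset.sum_congr rfl fun x _ => by rw [Set.indicator_apply]

lemma prod_tilt {q : ℕ → ℝ} (s : ℝ) {N L : ℕ} (ξ : Config (Fin N) L) :
    ∏ x, q (ξ x) * Real.exp (-(s * ξ x)) = (∏ x, q (ξ x)) * Real.exp (-(s * L)) := by
  rw [Finset.prod_mul_distrib, ← Real.exp_sum, Finset.sum_neg_distrib, ← Finset.mul_sum,
    ← Nat.cast_sum, ξ.2]

/-- The expected fraction of agents with scaled wealth in `I` under the law with weights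
`∏ x, q(ξ(x))`. -/
noncomputable def equilibriumFraction (q : ℕ → ℝ) (N L : ℕ) (a : ℝ) (I : Set ℝ) : ℝ :=
  (∑ ξ : Config (Fin N) L, (∏ x, q (ξ x)) *
      ((1 / (N : ℝ)) * ({x : Fin N | 1 / a * (ξ x : ℝ) ∈ I}.ncard : ℝ))) /
    ∑ ξ : Config (Fin N) L, ∏ x, q (ξ x)

/-- The mass of `I` under the exponentially tilted and rescaled law. -/
noncomputable def tiltedMass (q : ℕ → ℝ) (s a : ℝ) (I : Set ℝ) : ℝ :=
  (∑' k : ℕ, q k * Real.exp (-(s * k)) * I.indicator (fun _ => (1 : ℝ)) (1 / a * k)) /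
    partitionFn q s

/-- With the total fixed at `L`, the tilt multiplies every configuration by the same `e^{-sL}`,
which cancels. -/
lemma equilibriumFraction_tilt {q : ℕ → ℝ} (s : ℝ) (N L : ℕ) (a : ℝ) (I : Set ℝ) :
    (∑ ξ : Config (Fin (N + 1)) L, (∏ x, q (ξ x) * Real.exp (-(s * ξ x))) *
        ∑ x, I.indicator (fun _ => (1 : ℝ)) (1 / a * (ξ x : ℝ))) /
      convPow (fun k => q k * Real.exp (-(s * k))) (N + 1) L =
      (N + 1) * equilibriumFraction q (N + 1) L a I := by
  have he := (Real.exp_pos (-(s * L))).ne'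
  simp_rw [prod_tilt, convPow_mul_exp, mul_right_comm _ (Real.exp (-(s * L))), ← Finset.sum_mul]
  rw [mul_div_mul_right _ _ he, equilibriumFraction, sum_config_prod]
  simp_rw [ncard_eq_sum_indicator, mul_left_comm _ (1 / ((N + 1 : ℕ) : ℝ)), ← Finset.mul_sum]
  push_cast
  field_simp

namespace RegularGrowth

variable {q : ℕ → ℝ} {β : ℝ} (hq : RegularGrowth q β)
include hq

lemma tendsto_tiltedMass {θ : ℝ} (hθ : 0 < θ) {b : ℝ} (hb : 0 ≤ b) (c : EReal) :
    Tendsto (fun a : ℝ => tiltedMass q (θ / a) a (openInterval b c)) atTop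
      (𝓝 ((gammaMeasure (β + 1) θ).real (openInterval b c))) := by
  have hβ := hq.index_nonneg
  have hG : Real.Gamma (β + 1) ≠ 0 := (Real.Gamma_pos_of_pos (by linarith)).ne'
  have hθp : (1 / θ) ^ (β + 1) ≠ 0 := (Real.rpow_pos_of_pos (by positivity) _).ne'
  rw [gammaMeasure_real_openInterval (by linarith) hθ hb, add_sub_cancel_right]
  refine (((hq.tendsto_tilted_sum hθ (φ := (openInterval b c).indicator fun _ => (1 : ℝ))
    (fun r => ?_) (ae_continuousAt_indicator_openInterval b c)).2).div
    (hq.tendsto_partitionFn hθ) (mul_ne_zero hθp hG)).congr' ?_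
  · by_cases hr : r ∈ openInterval b c <;> simp [hr]
  · filter_upwards [eventually_gt_atTop 0] with a ha
    have := (hq.pos ⌊a⌋₊).ne'
    exact div_div_div_cancel_right₀ (by positivity) _ _

variable {a : ℕ → ℝ} {L : ℕ → ℕ} {T : ℝ} (ha : Tendsto a atTop atTop)
  (hLT : Tendsto (fun N : ℕ => (L N : ℝ) / ((N : ℝ) * a N)) atTop (𝓝 T))
include ha hLT

/-- The partition function is of order `a * q ⌊a⌋₊` and `(L+1)/a` is of order `N`, so the quotient
of the two sides grows at most linearly before the exponential factor. -/
lemma eventually_prefactor_le {θ C ε : ℝ} (hθ : 0 < θ) (hε : 0 < ε) :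
    ∀ᶠ N : ℕ in atTop, (L N + 1) * (C * q ⌊a N⌋₊ * Real.exp 1) ≤
      Real.exp (ε * N) * partitionFn q (θ / a N) := by
  have hβ := hq.index_nonneg
  have hG : 0 < Real.Gamma (β + 1) := Real.Gamma_pos_of_pos (by linarith)
  have hγ : (1 / θ) ^ (β + 1) * Real.Gamma (β + 1) ≠ 0 := by positivity
  have h1 : Tendsto (fun N : ℕ => ((L N : ℝ) + 1) / (N * a N)) atTop (𝓝 (T + 0)) := by
    have h2 : Tendsto (fun N : ℕ => 1 / ((N : ℝ) * a N)) atTop (𝓝 0) :=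
      (tendsto_natCast_atTop_atTop.atTop_mul_atTop₀ ha).const_div_atTop 1
    exact (hLT.add h2).congr fun N => by rw [add_div]
  have h3 := ((h1.mul_const (C * Real.exp 1)).div ((hq.tendsto_partitionFn hθ).comp ha) hγ)
  have h4 := h3.mul (tendsto_self_mul_const_pow_of_lt_one (Real.exp_pos (-ε)).le
    (Real.exp_lt_one_iff.2 (by linarith)))
  rw [mul_zero] at h4
  filter_upwards [h4.eventually (gt_mem_nhds one_pos), ha.eventually_gt_atTop 0,
    ha.eventually (hq.eventually_partitionFn_pos hθ), eventually_ge_atTop 1] with N hN haN hW hN1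
  have hN0 : (0 : ℝ) < N := by exact_mod_cast hN1
  have hqp := hq.pos ⌊a N⌋₊
  simp only [Pi.div_apply, Function.comp_apply] at hN
  rw [← Real.exp_nat_mul, mul_neg, Real.exp_neg, mul_comm (N : ℝ) ε] at hN
  have he := Real.exp_pos (ε * N)
  have h5 : ((L N : ℝ) + 1) / (N * a N) * (C * Real.exp 1) /
      (partitionFn q (θ / a N) / (a N * q ⌊a N⌋₊)) * (N * (Real.exp (ε * N))⁻¹) =
      ((L N + 1) * (C * q ⌊a N⌋₊ * Real.exp 1)) / (Real.exp (ε * N) * partitionFn q (θ / a N)) := by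
    field_simp
  rw [h5, div_lt_one (by positivity)] at hN
  exact hN.le

theorem tendsto_equilibriumFraction (hT : 0 < T) {b : ℝ} (hb : 0 ≤ b) (c : EReal) :
    Tendsto (fun N => equilibriumFraction q N (L N) (a N) (openInterval b c)) atTop
      (𝓝 ((gammaMeasure (β + 1) ((β + 1) / T)).real (openInterval b c))) := by
  have hβ := hq.index_nonneg
  set θ := (β + 1) / T with hθd
  have hθ : 0 < θ := div_pos (by linarith) hT
  set I := openInterval b c with hI
  obtain ⟨C, -, hC⟩ := hq.tilted_bound hθ
  have hclose : Tendsto (fun N => equilibriumFraction q N (L N) (a N) I -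
      tiltedMass q (θ / a N) (a N) I) atTop (𝓝 0) := by
    rw [Metric.tendsto_nhds]
    intro δ hδ
    -- With `t = ±τ` the bounds below give `t` times the error at most `3τ²`, so the error is at
    -- most `3τ < δ`. The condition `τ < 1` is needed for the Chernoff bound.
    obtain ⟨τ, hτ0, hτ⟩ := exists_between (lt_min (show 0 < δ / 3 by positivity) one_pos)
    have hτδ : τ < δ / 3 := hτ.trans_le (min_le_left _ _)
    have hτ1 : τ < 1 := hτ.trans_le (min_le_right _ _)
    have hε : 0 < τ ^ 2 := by positivity
    filter_upwards [hq.eventually_convPow_ge ha hLT hT hε,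
      hq.eventually_prefactor_le ha hLT (C := C) hθ hε, ha.eventually hC,
      ha.eventually (hq.eventually_summable_tilted hθ),
      ha.eventually (hq.eventually_partitionFn_pos hθ), eventually_ge_atTop 1]
      with N hlow hpre hCN hS hW hN
    obtain ⟨M, rfl⟩ : ∃ M, N = M + 1 := ⟨N - 1, by omega⟩
    have hM0 : (0 : ℝ) < ((M + 1 : ℕ) : ℝ) := by positivity
    have hZ : 0 < convPow (fun k => q k * Real.exp (-(θ / a (M + 1) * k))) (M + 1) (L (M + 1)) := by
      rw [convPow_mul_exp]
      have : 0 < partitionFn q (θ / a (M + 1)) ^ (M + 1) * Real.exp (-(τ ^ 2 * (M + 1 : ℕ))) := by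
        positivity
      exact pos_of_mul_pos_right (this.trans_le hlow) (by positivity)
    have key : ∀ t : ℝ, |t| = τ → t * (equilibriumFraction q (M + 1) (L (M + 1)) (a (M + 1)) I -
        tiltedMass q (θ / a (M + 1)) (a (M + 1)) I) ≤ 3 * τ ^ 2 := by
      intro t ht
      have ht2 : t ^ 2 = τ ^ 2 := by rw [← ht, sq_abs]
      have h1 := exp_mean_mul_convPow_le
        (w := fun k => q k * Real.exp (-(θ / a (M + 1) * k)))
        (f := fun k => I.indicator (fun _ => (1 : ℝ)) (1 / a (M + 1) * k))
        (fun k => mul_nonneg (hq.pos k).le (Real.exp_pos _).le) hS hW hCN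
        (fun k => Set.indicator_nonneg (fun _ _ => zero_le_one) _)
        (fun k => Set.indicator_le_self' (fun _ _ => zero_le_one) _) (t := t)
        (by rw [ht]; exact hτ1.le) M (L (M + 1)) hZ
      rw [equilibriumFraction_tilt] at h1
      change Real.exp (t * ((M + 1) * equilibriumFraction q (M + 1) (L (M + 1)) (a (M + 1)) I -
        (M + 1) * tiltedMass q (θ / a (M + 1)) (a (M + 1)) I)) * _ ≤
        _ * (partitionFn q (θ / a (M + 1)) * Real.exp (t ^ 2)) ^ M at h1
      rw [← mul_sub, mul_left_comm, ht2, convPow_mul_exp] at h1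
      set x := equilibriumFraction q (M + 1) (L (M + 1)) (a (M + 1)) I -
        tiltedMass q (θ / a (M + 1)) (a (M + 1)) I with hx
      set W := partitionFn q (θ / a (M + 1)) with hWd
      set Z := convPow q (M + 1) (L (M + 1)) * Real.exp (-(θ / a (M + 1) * L (M + 1))) with hZd
      set ℓ : ℝ := (L (M + 1) : ℝ) + 1 with hℓ
      have hℓ0 : 0 ≤ ℓ := by positivity
      have hWp : 0 < W ^ (M + 1) := pow_pos hW _
      -- Chernoff supplies only `M` factors of `W`; the missing one comes from the prefactor bound,
      -- so `W ^ (M + 1)` cancels.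
      have h2 : Real.exp ((M + 1) * (t * x)) * Real.exp (-(τ ^ 2 * (M + 1 : ℕ))) * W ^ (M + 1) ≤
          Real.exp (τ ^ 2 * (M + 1 : ℕ)) * Real.exp (τ ^ 2 * M) * W ^ (M + 1) := by
        calc Real.exp ((M + 1) * (t * x)) * Real.exp (-(τ ^ 2 * (M + 1 : ℕ))) * W ^ (M + 1)
            = Real.exp ((M + 1) * (t * x)) * (W ^ (M + 1) *
                Real.exp (-(τ ^ 2 * (M + 1 : ℕ)))) := by ring
          _ ≤ Real.exp ((M + 1) * (t * x)) * (ℓ * Z) := by gcongr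
          _ = ℓ * (Real.exp ((M + 1) * (t * x)) * Z) := by ring
          _ ≤ ℓ * (C * q ⌊a (M + 1)⌋₊ * Real.exp 1 * (W * Real.exp (τ ^ 2)) ^ M) := by gcongr
          _ = (ℓ * (C * q ⌊a (M + 1)⌋₊ * Real.exp 1)) * (W ^ M * Real.exp (τ ^ 2 * M)) := by
              rw [mul_pow, ← Real.exp_nat_mul, mul_comm (M : ℝ)]; ring
          _ ≤ (Real.exp (τ ^ 2 * (M + 1 : ℕ)) * W) * (W ^ M * Real.exp (τ ^ 2 * M)) := by gcongr
          _ = _ := by ring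
      have h3 := le_of_mul_le_mul_right h2 hWp
      rw [← Real.exp_add, ← Real.exp_add, Real.exp_le_exp] at h3
      push_cast at h3 hM0
      nlinarith
    have k1 := key τ (abs_of_pos hτ0)
    have k2 := key (-τ) (by rw [abs_neg, abs_of_pos hτ0])
    rw [Real.dist_eq, sub_zero]
    refine lt_of_le_of_lt (abs_le.2 ⟨?_, ?_⟩) (show 3 * τ < δ by linarith)
    · nlinarith
    · nlinarith
  have hlim := hclose.add ((hq.tendsto_tiltedMass hθ hb c).comp ha)
  rw [zero_add] at hlim
  exact hlim.congr fun N => by simp [hI]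

end RegularGrowth

/-! ### Regular variation of `G` in the three regimes -/

section RegularVariation

lemma RegularGrowth.of_tendsto_div_rpow {q : ℕ → ℝ} {β c : ℝ} (hpos : ∀ k, 0 < q k)
    (hmono : Monotone q) (hβ : 0 ≤ β) (hc : 0 < c)
    (h : Tendsto (fun k : ℕ => q k / ((k : ℝ) + 1) ^ β) atTop (𝓝 c)) : RegularGrowth q β := by
  refine ⟨hpos, hmono, hβ, fun r hr => ?_⟩
  have hfl : ∀ r : ℝ, 0 < r → Tendsto (fun a : ℝ => ⌊r * a⌋₊) atTop atTop := fun r hr =>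
    tendsto_nat_floor_atTop.comp (tendsto_id.const_mul_atTop hr)
  have hlin : ∀ r : ℝ, 0 < r → Tendsto (fun a : ℝ => ((⌊r * a⌋₊ : ℝ) + 1) / a) atTop (𝓝 r) :=
    fun r hr => by
      have := (tendsto_nat_floor_mul_div_atTop hr.le).add (tendsto_inv_atTop_zero (𝕜 := ℝ))
      rw [add_zero] at this
      exact this.congr fun a => by ring
  have h1 := (h.comp (hfl r hr)).div (h.comp (hfl 1 one_pos)) hc.ne'
  have h2 := ((hlin r hr).div (hlin 1 one_pos) one_ne_zero).rpow_const (p := β) (Or.inr hβ)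
  have h3 := h1.mul h2
  rw [div_self hc.ne', div_one, one_mul] at h3
  refine h3.congr' ?_
  filter_upwards [eventually_gt_atTop 0] with a ha
  simp only [Pi.div_apply, Function.comp_apply, one_mul]
  have hx : (0 : ℝ) < (⌊r * a⌋₊ : ℝ) + 1 := by positivity
  have hy : (0 : ℝ) < (⌊a⌋₊ : ℝ) + 1 := by positivity
  rw [div_div_div_cancel_right₀ ha.ne', Real.div_rpow hx.le hy.le]
  have := (Real.rpow_pos_of_pos hx β).ne'
  have := (Real.rpow_pos_of_pos hy β).ne'
  have := (hpos ⌊a⌋₊).ne'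
  field_simp

variable {g : ℕ → ℝ≥0}

lemma coe_G (g : ℕ → ℝ≥0) (k : ℕ) : (G g k : ℝ) = ∑ j ∈ Finset.range (k + 1), (g j : ℝ) := by
  rw [G]; push_cast; rfl

lemma monotone_G (g : ℕ → ℝ≥0) : Monotone fun k => (G g k : ℝ) := by
  refine monotone_nat_of_le_succ fun k => ?_
  rw [coe_G, coe_G, Finset.sum_range_succ _ (k + 1)]
  exact le_add_of_nonneg_right (g (k + 1)).2

lemma coe_G_pos (hg : 0 < g 0) (k : ℕ) : 0 < (G g k : ℝ) := by exact_mod_cast G_pos hg k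

lemma regularGrowth_of_summable (hg : 0 < g 0) (hs : Summable g) :
    RegularGrowth (fun k => (G g k : ℝ)) 0 := by
  have hs' : Summable fun k => (g k : ℝ) := NNReal.summable_coe.2 hs
  refine RegularGrowth.of_tendsto_div_rpow (c := ∑' k, (g k : ℝ)) (coe_G_pos hg) (monotone_G g)
    le_rfl (hs'.tsum_pos (fun k => (g k).2) 0 (by exact_mod_cast hg)) ?_
  simp only [Real.rpow_zero, div_one, coe_G]
  exact (tendsto_add_atTop_iff_nat 1).2 hs'.hasSum.tendsto_sum_nat

lemma summable_of_tendsto_div_rpow {α c : ℝ} (hα : α < -1)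
    (h : Tendsto (fun k : ℕ => (g k : ℝ) / (k : ℝ) ^ α) atTop (𝓝 c)) : Summable g := by
  rw [← NNReal.summable_coe]
  refine summable_of_isBigO_nat (Real.summable_nat_rpow.2 hα) ?_
  refine Asymptotics.isBigO_of_div_tendsto_nhds ?_ c h
  filter_upwards [eventually_gt_atTop 0] with k hk h0
  exact absurd h0 (Real.rpow_pos_of_pos (by exact_mod_cast hk) α).ne'

lemma tendsto_rpow_increment_div (β : ℝ) :
    Tendsto (fun j : ℕ => (((j : ℝ) + 1) ^ β - (j : ℝ) ^ β) / (j : ℝ) ^ (β - 1)) atTop (𝓝 β) := by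
  have hd : HasDerivAt (fun x : ℝ => x ^ β) (β * 1 ^ (β - 1)) 1 :=
    Real.hasDerivAt_rpow_const (Or.inl one_ne_zero)
  rw [Real.one_rpow, mul_one] at hd
  have ht : Tendsto (fun j : ℕ => ((j : ℝ))⁻¹) atTop (𝓝[≠] 0) := by
    refine tendsto_nhdsWithin_iff.2 ⟨tendsto_inv_atTop_nhds_zero_nat, ?_⟩
    filter_upwards [eventually_gt_atTop 0] with j hj
    simpa using hj.ne'
  refine (hd.tendsto_slope_zero.comp ht).congr' ?_
  filter_upwards [eventually_gt_atTop 0] with j hj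
  have hj0 : (0 : ℝ) < j := by exact_mod_cast hj
  have h1 : (1 + (j : ℝ)⁻¹) ^ β * (j : ℝ) ^ β = ((j : ℝ) + 1) ^ β := by
    rw [← Real.mul_rpow (by positivity) hj0.le]
    congr 1
    field_simp
  have h2 := (Real.rpow_pos_of_pos hj0 β).ne'
  simp only [Function.comp_apply, inv_inv, smul_eq_mul, Real.one_rpow]
  rw [Real.rpow_sub_one hj0.ne', ← h1]
  field_simp

/-- A Stolz–Cesàro argument: `g(j)` is compared with the increments of `j^(α+1)`, which are
asymptotic to `(α+1) j^α` and telescope. -/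
lemma regularGrowth_of_tendsto_div_rpow (hg : 0 < g 0) {α c : ℝ} (hα : -1 < α) (hc : 0 < c)
    (h : Tendsto (fun k : ℕ => (g k : ℝ) / (k : ℝ) ^ α) atTop (𝓝 c)) :
    RegularGrowth (fun k => (G g k : ℝ)) (α + 1) := by
  have hβ : 0 < α + 1 := by linarith
  set d : ℕ → ℝ := fun j => ((j + 1 : ℕ) : ℝ) ^ (α + 1) - (j : ℝ) ^ (α + 1) with hd
  have hd0 : ∀ j, 0 < d j := fun j => by
    rw [hd, sub_pos]
    exact Real.rpow_lt_rpow (Nat.cast_nonneg j) (by push_cast; linarith) hβ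
  have hsum : ∀ n, ∑ j ∈ Finset.range n, d j = (n : ℝ) ^ (α + 1) := fun n => by
    rw [Finset.sum_range_sub fun j : ℕ => (j : ℝ) ^ (α + 1)]
    simp [Real.zero_rpow hβ.ne']
  have hgd : Tendsto (fun j => (g j : ℝ) / d j) atTop (𝓝 (c / (α + 1))) := by
    have h1 := h.div (tendsto_rpow_increment_div (α + 1)) hβ.ne'
    refine h1.congr' ?_
    filter_upwards [eventually_gt_atTop 0] with j hj
    have := (Real.rpow_pos_of_pos (Nat.cast_pos.2 hj : (0 : ℝ) < j) α).ne'
    simp only [Pi.div_apply, add_sub_cancel_right, hd]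
    push_cast
    exact div_div_div_cancel_right₀ this _ _
  have hlo : (fun j => (g j : ℝ) - c / (α + 1) * d j) =o[atTop] d := by
    refine (Asymptotics.isLittleO_iff_tendsto fun j hj => absurd hj (hd0 j).ne').2 ?_
    have := hgd.sub_const (c / (α + 1))
    rw [sub_self] at this
    refine this.congr fun j => ?_
    have := (hd0 j).ne'
    field_simp
  have hdiv : Tendsto (fun n => ∑ j ∈ Finset.range n, d j) atTop atTop := by
    simp_rw [hsum]
    exact (tendsto_rpow_atTop hβ).comp tendsto_natCast_atTop_atTop
  have h2 := (hlo.sum_range (fun j => (hd0 j).le) hdiv).tendsto_div_nhds_zero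
  refine RegularGrowth.of_tendsto_div_rpow (coe_G_pos hg) (monotone_G g) hβ.le
    (div_pos hc hβ) ?_
  have h3 := ((tendsto_add_atTop_iff_nat 1).2 h2).add_const (c / (α + 1))
  rw [zero_add] at h3
  refine h3.congr fun k => ?_
  have := (Real.rpow_pos_of_pos (by positivity : (0 : ℝ) < (k : ℝ) + 1) (α + 1)).ne'
  rw [Finset.sum_sub_distrib, ← Finset.mul_sum, hsum, coe_G]
  push_cast
  field_simp
  ring

/-- In the critical case `α = -1`, `G` diverges without being asymptotic to a constant. The terms
between `a` and `r * a` add only a bounded amount, so the ratio still tends to one. -/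
lemma regularGrowth_of_tendsto_mul (hg : 0 < g 0) {c : ℝ} (hc : 0 < c)
    (h : Tendsto (fun k : ℕ => (g k : ℝ) * k) atTop (𝓝 c)) :
    RegularGrowth (fun k => (G g k : ℝ)) 0 := by
  have hnot : ¬ Summable fun k => (g k : ℝ) := by
    intro hs
    refine Real.not_summable_natCast_inv (summable_of_isBigO_nat hs ?_)
    have h1 := (h.inv₀ hc.ne').isBigO_one ℝ
    have h2 : (fun k : ℕ => (k : ℝ)⁻¹) =ᶠ[atTop] fun k : ℕ => (g k : ℝ) * ((g k : ℝ) * k)⁻¹ := by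
      filter_upwards [h.eventually (lt_mem_nhds hc)] with k hk
      have : (g k : ℝ) ≠ 0 := fun h0 => by simp [h0] at hk
      field_simp
    exact h2.trans_isBigO (by simpa using (Asymptotics.isBigO_refl (fun k => (g k : ℝ)) _).mul h1)
  have htop : Tendsto (fun k => (G g k : ℝ)) atTop atTop := by
    simp_rw [coe_G]
    exact (tendsto_add_atTop_iff_nat 1).2
      ((not_summable_iff_tendsto_nat_atTop_of_nonneg fun k => (g k).2).1 hnot)
  obtain ⟨C, hC⟩ := h.bddAbove_range
  have hgC : ∀ k, (g k : ℝ) * k ≤ C := fun k => hC ⟨k, rfl⟩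
  have hge : ∀ r : ℝ, 1 ≤ r →
      Tendsto (fun a : ℝ => (G g ⌊r * a⌋₊ : ℝ) / G g ⌊a⌋₊) atTop (𝓝 1) := by
    intro r hr
    have htop' : Tendsto (fun a : ℝ => (G g ⌊a⌋₊ : ℝ)) atTop atTop :=
      htop.comp tendsto_nat_floor_atTop
    have hup : Tendsto (fun a : ℝ => 1 + 2 * r * C / G g ⌊a⌋₊) atTop (𝓝 1) := by
      simpa using (htop'.const_div_atTop (2 * r * C)).const_add 1
    refine tendsto_of_tendsto_of_tendsto_of_le_of_le' tendsto_const_nhds hup ?_ ?_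
    · filter_upwards [eventually_ge_atTop 0] with a ha
      rw [le_div_iff₀ (coe_G_pos hg _), one_mul]
      exact monotone_G g (Nat.floor_mono (le_mul_of_one_le_left ha hr))
    · filter_upwards [eventually_ge_atTop 2] with a ha
      have hG := coe_G_pos hg ⌊a⌋₊
      rw [div_le_iff₀ hG, add_mul, one_mul, div_mul_cancel₀ _ hG.ne']
      have hle : ⌊a⌋₊ ≤ ⌊r * a⌋₊ := Nat.floor_mono (le_mul_of_one_le_left (by linarith) hr)
      have hfa : a / 2 ≤ ⌊a⌋₊ := by linarith [Nat.lt_floor_add_one a]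
      have hC0 : 0 ≤ C := (mul_nonneg (g 0).2 (Nat.cast_nonneg 0)).trans (hgC 0)
      have hsplit := Finset.sum_range_add_sum_Ico (fun j => (g j : ℝ)) (Nat.succ_le_succ hle)
      rw [coe_G, coe_G, ← hsplit]
      refine add_le_add le_rfl ?_
      have hterm : ∀ j ∈ Finset.Ico (⌊a⌋₊ + 1) (⌊r * a⌋₊ + 1), (g j : ℝ) ≤ C / (a / 2) := by
        intro j hj
        have hj1 : (⌊a⌋₊ : ℝ) ≤ j := by exact_mod_cast (by simp at hj; omega : ⌊a⌋₊ ≤ j)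
        rw [le_div_iff₀ (by linarith)]
        exact (mul_le_mul_of_nonneg_left (hfa.trans hj1) (g j).2).trans (hgC j)
      refine (Finset.sum_le_card_nsmul _ _ _ hterm).trans ?_
      rw [Nat.card_Ico, nsmul_eq_mul]
      have hcard : ((⌊r * a⌋₊ + 1 - (⌊a⌋₊ + 1) : ℕ) : ℝ) ≤ r * a := by
        refine le_trans ?_ (Nat.floor_le (by positivity : 0 ≤ r * a))
        exact_mod_cast (by omega : ⌊r * a⌋₊ + 1 - (⌊a⌋₊ + 1) ≤ ⌊r * a⌋₊)
      have ha0 : 0 < a := by linarith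
      calc ((⌊r * a⌋₊ + 1 - (⌊a⌋₊ + 1) : ℕ) : ℝ) * (C / (a / 2)) ≤ r * a * (C / (a / 2)) := by
            gcongr
        _ = 2 * r * C := by field_simp
  refine ⟨coe_G_pos hg, monotone_G g, le_rfl, fun r hr => ?_⟩
  rw [Real.rpow_zero]
  rcases le_total 1 r with h1 | h1
  · exact hge r h1
  -- For `r ≤ 1`, the case `r⁻¹` is applied at `r * a` and the ratio inverted.
  · have h2 := ((hge r⁻¹ ((one_le_inv₀ hr).2 h1)).comp
      (tendsto_id.const_mul_atTop hr)).inv₀ one_ne_zero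
    rw [inv_one] at h2
    refine h2.congr fun a => ?_
    simp only [Function.comp_apply, id, inv_div, inv_mul_cancel_left₀ hr.ne']

/-! ### Assembly of the iterated limits -/

theorem iteratedLimit_of_regularGrowth {β : ℝ} (hg : 0 < g 0)
    (hq : RegularGrowth (fun k => (G g k : ℝ)) β)
    {ρ : ∀ N : ℕ, 2 ≤ N → PMF (ExchangeSet N)}
    (hρ : ∀ (N : ℕ) (hN : 2 ≤ N), HypergraphConnected (ρ N hN))
    {L : ℕ → ℕ} {a : ℕ → ℝ} (ha : Tendsto a atTop atTop) {T : ℝ} (hT : 0 < T)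
    (hLT : Tendsto (fun N : ℕ => (L N : ℝ) / ((N : ℝ) * a N)) atTop (𝓝 T))
    {b : ℝ} (hb : 0 ≤ b) (c : EReal)
    {step : ∀ N, 2 ≤ N → Config (Fin N) (L N) → PMF (Config (Fin N) (L N))}
    (hmove : ∀ N hN, AllowsCoinMoves (ρ N hN) (step N hN))
    (hstat : ∀ N hN (f : Config (Fin N) (L N) → ℝ≥0∞),
      ∑' ξ, weight g ξ * ∑' η, step N hN ξ η * f η = ∑' ξ, weight g ξ * f ξ) :
    IteratedLimit step a (openInterval b c)
      ((gammaMeasure (β + 1) ((β + 1) / T)).real (openInterval b c)) :=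
  ⟨fun N => equilibriumFraction (fun k => (G g k : ℝ)) N (L N) (a N) (openInterval b c),
    fun N hN η => tendsto_expectedFraction hg (hρ N hN) (hmove N hN) (hstat N hN) (a N) _ η,
    hq.tendsto_equilibriumFraction ha hLT hT hb c⟩

/-- The exponential law is the Gamma law of shape one, so index `β = 0` yields `π_T`. -/
lemma gammaMeasure_one_eq_expLaw (T : ℝ) : gammaMeasure (0 + 1) ((0 + 1) / T) = expLaw T := by
  rw [zero_add]; rfl

/-- The index of regular variation of `G` determines the limit law. -/
lemma exists_regularGrowth_limitLaw (hg : 0 < g 0) {α c : ℝ} (hc : 0 < c)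
    (h : Tendsto (fun k : ℕ => (g k : ℝ) / (k : ℝ) ^ α) atTop (𝓝 c)) (T : ℝ) :
    ∃ β, RegularGrowth (fun k => (G g k : ℝ)) β ∧
      gammaMeasure (β + 1) ((β + 1) / T) = limitLaw α T := by
  rcases lt_trichotomy α (-1) with hα | hα | hα
  · refine ⟨0, regularGrowth_of_summable hg (summable_of_tendsto_div_rpow hα h), ?_⟩
    rw [gammaMeasure_one_eq_expLaw, limitLaw, if_neg hα.not_gt]
  · subst hα
    refine ⟨0, regularGrowth_of_tendsto_mul hg hc (h.congr fun k => ?_), ?_⟩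
    · rw [Real.rpow_neg_one, div_inv_eq_mul]
    · rw [gammaMeasure_one_eq_expLaw, limitLaw, if_neg (lt_irrefl _)]
  · refine ⟨α + 1, regularGrowth_of_tendsto_div_rpow hg hα hc h, ?_⟩
    rw [limitLaw, if_pos hα, add_assoc, one_add_one_eq_two]

end RegularVariation

end MoneyExchange

theorem corollary1
    (ρ : ∀ N : ℕ, 2 ≤ N → PMF (MoneyExchange.ExchangeSet N))
    (hρ : ∀ (N : ℕ) (hN : 2 ≤ N), MoneyExchange.HypergraphConnected (ρ N hN))
    (L : ℕ → ℕ) (hL : ∀ N : ℕ, 1 ≤ N → 0 < L N)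
    (a : ℕ → ℝ) (ha : Tendsto a atTop atTop)
    (T : ℝ) (hT : 0 < T)
    (hLT : Tendsto (fun N : ℕ => (L N : ℝ) / ((N : ℝ) * a N)) atTop (𝓝 T))
    (b : ℝ) (c : EReal) (hb : 0 ≤ b) (hbc : (b : EReal) < c) :
    (∀ (g : ℕ → ℝ≥0) (hg : 0 < g 0),
      (∀ α cα : ℝ, 0 < cα →
        Tendsto (fun k : ℕ => (g k : ℝ) / (k : ℝ) ^ α) atTop (𝓝 cα) →
        (0 < g 1 → MoneyExchange.IteratedLimit (L := L)
          (fun N hN => MoneyExchange.immediateExchange g hg (ρ N hN)) a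
          (MoneyExchange.openInterval b c)
          ((MoneyExchange.limitLaw α T).real (MoneyExchange.openInterval b c))) ∧
        MoneyExchange.IteratedLimit (L := L)
          (fun N hN => MoneyExchange.randomSaving g hg (ρ N hN)) a
          (MoneyExchange.openInterval b c)
          ((MoneyExchange.limitLaw α T).real (MoneyExchange.openInterval b c))) ∧
      (Summable g →
        (0 < g 1 → MoneyExchange.IteratedLimit (L := L)
          (fun N hN => MoneyExchange.immediateExchange g hg (ρ N hN)) a
          (MoneyExchange.openInterval b c)
          ((MoneyExchange.expLaw T).real (MoneyExchange.openInterval b c))) ∧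
        MoneyExchange.IteratedLimit (L := L)
          (fun N hN => MoneyExchange.randomSaving g hg (ρ N hN)) a
          (MoneyExchange.openInterval b c)
          ((MoneyExchange.expLaw T).real (MoneyExchange.openInterval b c)))) ∧
    MoneyExchange.IteratedLimit (L := L)
      (fun N hN => MoneyExchange.uniformReshuffling (ρ N hN)) a
      (MoneyExchange.openInterval b c)
      ((MoneyExchange.expLaw T).real (MoneyExchange.openInterval b c)) := by
  have hmain : ∀ (g : ℕ → ℝ≥0) (hg : 0 < g 0) (β : ℝ),
      MoneyExchange.RegularGrowth (fun k => (MoneyExchange.G g k : ℝ)) β →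
      (0 < g 1 → MoneyExchange.IteratedLimit (L := L)
        (fun N hN => MoneyExchange.immediateExchange g hg (ρ N hN)) a
        (MoneyExchange.openInterval b c)
        ((gammaMeasure (β + 1) ((β + 1) / T)).real (MoneyExchange.openInterval b c))) ∧
      MoneyExchange.IteratedLimit (L := L)
        (fun N hN => MoneyExchange.randomSaving g hg (ρ N hN)) a
        (MoneyExchange.openInterval b c)
        ((gammaMeasure (β + 1) ((β + 1) / T)).real (MoneyExchange.openInterval b c)) :=
    fun g hg β hq =>
      ⟨fun hg1 => MoneyExchange.iteratedLimit_of_regularGrowth hg hq hρ ha hT hLT hb c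
        (fun N hN => MoneyExchange.allowsCoinMoves_immediateExchange hg hg1 (ρ N hN))
        fun N hN => MoneyExchange.tsum_weight_mul_immediateExchange g hg (ρ N hN),
      MoneyExchange.iteratedLimit_of_regularGrowth hg hq hρ ha hT hLT hb c
        (fun N hN => MoneyExchange.allowsCoinMoves_randomSaving hg (ρ N hN))
        fun N hN => MoneyExchange.tsum_weight_mul_randomSaving g hg (ρ N hN)⟩
  have hsummable : ∀ (g : ℕ → ℝ≥0) (hg : 0 < g 0), Summable g →
      (0 < g 1 → MoneyExchange.IteratedLimit (L := L)
        (fun N hN => MoneyExchange.immediateExchange g hg (ρ N hN)) a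
        (MoneyExchange.openInterval b c)
        ((MoneyExchange.expLaw T).real (MoneyExchange.openInterval b c))) ∧
      MoneyExchange.IteratedLimit (L := L)
        (fun N hN => MoneyExchange.randomSaving g hg (ρ N hN)) a
        (MoneyExchange.openInterval b c)
        ((MoneyExchange.expLaw T).real (MoneyExchange.openInterval b c)) := fun g hg hs => by
    have h := hmain g hg 0 (MoneyExchange.regularGrowth_of_summable hg hs)
    rwa [MoneyExchange.gammaMeasure_one_eq_expLaw] at h
  -- Uniform reshuffling is random saving for the summable sequence `δ₀`, so it falls under the
  -- summable case.
  refine ⟨fun g hg => ⟨fun α cα hcα hlim => ?_, hsummable g hg⟩,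
    (hsummable (Pi.single 0 1) (by simp) (hasSum_pi_single 0 1).summable).2⟩
  obtain ⟨β, hq, hlaw⟩ := MoneyExchange.exists_regularGrowth_limitLaw hg hcα hlim T
  rw [← hlaw]
  exact hmain g hg β hq
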